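/- Let $k$ be a field of characteristic zero, $R = k[x_1,\dots,x_n]$ with its standard grading ($\deg x_i = 1$), $\widehat R = k[[x_1,\dots,x_n]]$, and let $\mathscr D = \mathscr D(R,k)$ be the ring of $k$-linear differential operators on $R$, with $\partial_1,\dots,\partial_n \in \mathscr D$ the partial derivatives. Let $M$ be a finitely generated left $\mathscr D$-module that is graded, i.e. there is a direct sum decomposition $M = \bigoplus_{l\in\mathbb Z} M_l$ with $R_d\, M_l \subseteq M_{d+l}$ and $\partial_i M_l \subseteq M_{l-1}$ for all $d \ge 0$, $l\in\mathbb Z$ and $1\le i\le n$. The completion $\widehat M = \widehat R\otimes_R M$ carries the operators $\partial_i(\widehat s\otimes m) = \partial_i(\widehat s)\otimes m + \widehat s\otimes \partial_i m$, which make it a left module over $\mathscr D(\widehat R,k)$. For $N = M$ or $N = \widehat M$, let $H^i_{\mathrm{dR}}(N)$ be the $i$-th cohomology of the de Rham complex $\Omega^\bullet(N)$, where $\Omega^i(N) = \bigoplus_{j_1<\dots<j_i} N\,dx_{j_1}\wedge\dots\wedge dx_{j_i}$ and $d(m\,dx_{j_1}\wedge\dots\wedge dx_{j_i}) = \sum_{s=1}^n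 \partial_s(m)\,dx_s\wedge dx_{j_1}\wedge\dots\wedge dx_{j_i}$. The map $M\to\widehat M$, $m\mapsto 1\otimes m$, commutes with the $\partial_s$ and so induces $k$-linear maps $$\kappa^i\colon H^i_{\mathrm{dR}}(M)\to H^i_{\mathrm{dR}}(\widehat R\otimes_R M)\qquad (i\ge 0).$$ Then: (a) $\kappa^i$ is injective for every $i\ge 0$; (b) for each $i\ge 0$ such that $\dim_k H^i_{\mathrm{dR}}(M)<\infty$, the map $\kappa^i$ is an isomorphism of $k$-vector spaces. -/

import Mathlib

open scoped TensorProduct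

noncomputable section

namespace DMod

/-! ### Rings of differential operators -/

section DiffOp

variable (k A : Type*) [CommRing k] [CommRing A] [Algebra k A]

/-- `k`-linear differential operators of order at most `p` on a commutative `k`-algebra `A`
(Grothendieck's inductive definition): order at most `0` means commuting with multiplication by
every `a : A`, and order at most `p + 1` means that `[P, a]` has order at most `p` for all `a`. -/
def HasOrderLE : ℕ → Module.End k A → Prop
  | 0, P => ∀ a : A, P * Algebra.lmul k A a - Algebra.lmul k A a * P = 0
  | p + 1, P => ∀ a : A, HasOrderLE p (P * Algebra.lmul k A a - Algebra.lmul k A a * P)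

variable {k A}

theorem HasOrderLE.zero (p : ℕ) : HasOrderLE k A p 0 := by
  induction p with
  | zero => intro a; simp
  | succ p ih => intro a; simpa using ih

theorem HasOrderLE.succ {p : ℕ} {P : Module.End k A} (h : HasOrderLE k A p P) :
    HasOrderLE k A (p + 1) P := by
  induction p generalizing P with
  | zero => intro a; rw [h a]; exact HasOrderLE.zero 0
  | succ p ih => intro a; exact ih (h a)

theorem HasOrderLE.mono {p q : ℕ} (hpq : p ≤ q) {P : Module.End k A} (h : HasOrderLE k A p P) :
    HasOrderLE k A q P := by
  induction hpq with
  | refl => exact h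
  | step _ ih => exact ih.succ

theorem HasOrderLE.add {p : ℕ} {P Q : Module.End k A} (hP : HasOrderLE k A p P)
    (hQ : HasOrderLE k A p Q) : HasOrderLE k A p (P + Q) := by
  induction p generalizing P Q with
  | zero =>
    intro a
    rw [add_mul, mul_add, add_sub_add_comm, hP a, hQ a, add_zero]
  | succ p ih =>
    intro a
    rw [add_mul, mul_add, add_sub_add_comm]
    exact ih (hP a) (hQ a)

theorem HasOrderLE.mul {p q : ℕ} {P Q : Module.End k A} (hP : HasOrderLE k A p P)
    (hQ : HasOrderLE k A q Q) : HasOrderLE k A (p + q) (P * Q) := by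
  have key : ∀ (P Q : Module.End k A) (a : A),
      P * Q * Algebra.lmul k A a - Algebra.lmul k A a * (P * Q) =
        P * (Q * Algebra.lmul k A a - Algebra.lmul k A a * Q) +
          (P * Algebra.lmul k A a - Algebra.lmul k A a * P) * Q := by
    intro P Q a
    simp only [mul_sub, sub_mul, mul_assoc]
    abel
  induction hN : p + q generalizing p q P Q with
  | zero =>
    obtain ⟨rfl, rfl⟩ : p = 0 ∧ q = 0 := by omega
    intro a
    rw [key, hP a, hQ a, mul_zero, zero_mul, add_zero]
  | succ N ih =>
    intro a
    rw [key]
    refine HasOrderLE.add ?_ ?_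
    · cases q with
      | zero => rw [hQ a, mul_zero]; exact HasOrderLE.zero N
      | succ q => exact ih hP (hQ a) (by omega)
    · cases p with
      | zero => rw [hP a, zero_mul]; exact HasOrderLE.zero N
      | succ p => exact ih (hP a) hQ (by omega)

theorem HasOrderLE.lmul (a : A) : HasOrderLE k A 0 (Algebra.lmul k A a) := by
  intro b
  rw [← map_mul, ← map_mul, mul_comm, sub_self]

theorem HasOrderLE.derivation (δ : Derivation k A A) :
    HasOrderLE k A 1 (δ : A →ₗ[k] A) := by
  intro a
  have h : (δ : A →ₗ[k] A) * Algebra.lmul k A a - Algebra.lmul k A a * (δ : A →ₗ[k] A) =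
      Algebra.lmul k A (δ a) := by
    ext b
    simp [mul_comm]
  rw [h]
  exact HasOrderLE.lmul _

variable (k A)

/-- The ring `𝒟(A, k)` of `k`-linear differential operators on `A`. -/
def DiffOp : Subalgebra k (Module.End k A) where
  carrier := {P | ∃ p, HasOrderLE k A p P}
  mul_mem' := fun ⟨p, hP⟩ ⟨q, hQ⟩ => ⟨p + q, hP.mul hQ⟩
  add_mem' := fun ⟨p, hP⟩ ⟨q, hQ⟩ =>
    ⟨max p q, (hP.mono (le_max_left p q)).add (hQ.mono (le_max_right p q))⟩
  algebraMap_mem' c := ⟨0, by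
    have h : algebraMap k (Module.End k A) c = Algebra.lmul k A (algebraMap k A c) := by
      ext b
      simp [Algebra.smul_def]
    rw [h]
    exact HasOrderLE.lmul _⟩

/-- The inclusion `A → 𝒟(A, k)`, sending `a` to multiplication by `a`. -/
def mulOp : A →ₐ[k] DiffOp k A :=
  (Algebra.lmul k A).codRestrict (DiffOp k A) fun a => ⟨0, HasOrderLE.lmul a⟩

variable {k A}

/-- A derivation, as an element of the ring of differential operators. -/
def derivOp (δ : Derivation k A A) : DiffOp k A :=
  ⟨(δ : A →ₗ[k] A), 1, HasOrderLE.derivation δ⟩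

theorem derivOp_mul_mulOp (δ : Derivation k A A) (a : A) :
    derivOp δ * mulOp k A a = mulOp k A a * derivOp δ + mulOp k A (δ a) := by
  apply Subtype.ext
  refine LinearMap.ext fun b => ?_
  change δ (a * b) = a * δ b + δ a * b
  simp [mul_comm]

theorem derivOp_comm {δ ε : Derivation k A A} (h : ∀ a, δ (ε a) = ε (δ a)) :
    derivOp δ * derivOp ε = derivOp ε * derivOp δ :=
  Subtype.ext (LinearMap.ext h)

end DiffOp

/-! ### Modules with commuting operators `∂₁, …, ∂ₙ`, and their de Rham cohomology -/

/-- Commuting `k`-linear operators `∂₁, …, ∂ₙ` on an `A`-module `N` that satisfy the Leibniz rule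
with respect to given `k`-derivations `δ₁, …, δₙ` of `A`. For `A = k[x₁, …, xₙ]` or
`A = k[[x₁, …, xₙ]]`, `k` a field of characteristic zero and `δᵢ` the partial derivatives, this is
the same as a left `𝒟(A, k)`-module structure extending the `A`-module structure. -/
structure Connection {k A : Type*} [CommRing k] [CommRing A] [Algebra k A] {n : ℕ}
    (δ : Fin n → Derivation k A A) (N : Type*) [AddCommGroup N] [Module k N] [Module A N] where
  op : Fin n → Module.End k N
  leibniz : ∀ i (a : A) (m : N), op i (a • m) = a • op i m + δ i a • m
  comm : ∀ i j m, op i (op j m) = op j (op i m)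

/-- `Ωⁱ(N)`: the direct sum of copies `N dx_{j₁} ∧ ⋯ ∧ dx_{jᵢ}` of `N` over all
`j₁ < ⋯ < jᵢ`, the indices being recorded as the set `{j₁, …, jᵢ}`. -/
abbrev Form (n : ℕ) (N : Type*) (i : ℕ) : Type _ :=
  {S : Finset (Fin n) // S.card = i} → N

/-- The sign with `dx_s ∧ dx_{T ∖ s} = wedgeSign s T • dx_T`, for `s ∈ T`: it is `(-1)` to the
number of elements of `T` that `s` has to be moved past. -/
def wedgeSign {n : ℕ} (s : Fin n) (T : Finset (Fin n)) : ℤ :=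
  (-1) ^ (T.filter (· < s)).card

section DeRham

variable {k A : Type*} [CommRing k] [CommRing A] [Algebra k A] {n : ℕ}
  {δ : Fin n → Derivation k A A}
  {N : Type*} [AddCommGroup N] [Module k N] [Module A N]

/-- The de Rham differential `m dx_S ↦ ∑ₛ ∂ₛ m dxₛ ∧ dx_S`, written out in coordinates: the
coefficient of `dx_T` in `d ω` is `∑_{s ∈ T} ± ∂ₛ ω_{T ∖ s}`. -/
def Connection.d (D : Connection δ N) (i : ℕ) : Form n N i →ₗ[k] Form n N (i + 1) where
  toFun ω T := ∑ s : T.1, wedgeSign s.1 T.1 •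
    D.op s.1 (ω ⟨T.1.erase s.1, by rw [Finset.card_erase_of_mem s.2, T.2]; rfl⟩)
  map_add' ω η := by
    funext T
    simp [smul_add, Finset.sum_add_distrib]
  map_smul' c ω := by
    funext T
    simp [Finset.smul_sum, smul_comm c]

theorem wedgeSign_swap {s t : Fin n} {T : Finset (Fin n)} (hs : s ∈ T) (ht : t ∈ T)
    (hst : s ≠ t) :
    wedgeSign t T * wedgeSign s (T.erase t) = -(wedgeSign s T * wedgeSign t (T.erase s)) := by
  wlog h : s < t generalizing s t with H
  · rw [H ht hs hst.symm (lt_of_le_of_ne (not_lt.mp h) hst.symm), neg_neg]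
  have h1 : (T.erase t).filter (· < s) = T.filter (· < s) := by
    ext x
    simp only [Finset.mem_filter, Finset.mem_erase]
    exact ⟨fun hx => ⟨hx.1.2, hx.2⟩, fun hx => ⟨⟨(hx.2.trans h).ne, hx.1⟩, hx.2⟩⟩
  have h2 : (T.erase s).filter (· < t) = (T.filter (· < t)).erase s := by
    ext x
    simp only [Finset.mem_filter, Finset.mem_erase, and_assoc]
  have h3 : (T.filter (· < t)).card = ((T.filter (· < t)).erase s).card + 1 :=
    (Finset.card_erase_add_one (Finset.mem_filter.mpr ⟨hs, h⟩)).symm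
  simp only [wedgeSign, h1, h2, h3, pow_succ]
  ring

theorem Connection.d_d (D : Connection δ N) (i : ℕ) (ω : Form n N i) :
    D.d (i + 1) (D.d i ω) = 0 := by
  funext T
  simp only [Connection.d, LinearMap.coe_mk, AddHom.coe_mk, map_sum, map_zsmul, Finset.smul_sum,
    smul_smul, Pi.zero_apply]
  rw [Finset.sum_sigma']
  refine Finset.sum_involution
    (fun p _ => ⟨⟨p.2.1, Finset.mem_of_mem_erase p.2.2⟩,
      ⟨p.1.1, Finset.mem_erase.mpr ⟨(Finset.ne_of_mem_erase p.2.2).symm, p.1.2⟩⟩⟩)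
    ?_ ?_ (fun _ _ => Finset.mem_sigma.mpr ⟨Finset.mem_univ _, Finset.mem_univ _⟩)
    (fun _ _ => rfl)
  · rintro ⟨⟨s, hs⟩, ⟨t, ht⟩⟩ -
    have hts : t ≠ s := Finset.ne_of_mem_erase ht
    simp only
    rw [wedgeSign_swap (Finset.mem_of_mem_erase ht) hs hts, D.comm s t, neg_smul]
    have h : (T.1.erase s).erase t = (T.1.erase t).erase s := Finset.erase_right_comm
    simp only [h]
    exact neg_add_cancel _
  · rintro ⟨⟨s, hs⟩, ⟨t, ht⟩⟩ - - h
    exact Finset.ne_of_mem_erase ht (congrArg (fun p => p.1.1) h)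

/-- The image of `d^{i-1}` in `Ωⁱ(N)` (zero for `i = 0`). -/
def Connection.coboundaries (D : Connection δ N) : (i : ℕ) → Submodule k (Form n N i)
  | 0 => ⊥
  | i + 1 => LinearMap.range (D.d i)

/-- The kernel of `d^i` in `Ωⁱ(N)`. -/
def Connection.cocycles (D : Connection δ N) (i : ℕ) : Submodule k (Form n N i) :=
  LinearMap.ker (D.d i)

/-- `Hⁱ_dR(N) = ker d^i / im d^{i-1}`. -/
abbrev Connection.Cohomology (D : Connection δ N) (i : ℕ) : Type _ :=
  D.cocycles i ⧸ (D.coboundaries i).submoduleOf (D.cocycles i)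

variable {B : Type*} [CommRing B] [Algebra k B] {ε : Fin n → Derivation k B B}
  {N' : Type*} [AddCommGroup N'] [Module k N'] [Module B N']

theorem Connection.d_comp (D : Connection δ N) (E : Connection ε N') (f : N →ₗ[k] N')
    (hf : ∀ s m, f (D.op s m) = E.op s (f m)) (i : ℕ) (ω : Form n N i) :
    E.d i (f ∘ ω) = f ∘ D.d i ω := by
  funext T
  simp [Connection.d, hf]

theorem Connection.comp_mem_cocycles (D : Connection δ N) (E : Connection ε N') (f : N →ₗ[k] N')
    (hf : ∀ s m, f (D.op s m) = E.op s (f m)) (i : ℕ) :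
    ∀ ω ∈ D.cocycles i, f.compLeft _ ω ∈ E.cocycles i := by
  intro ω hω
  have h : D.d i ω = 0 := hω
  change E.d i (f ∘ ω) = 0
  rw [D.d_comp E f hf, h]
  funext T
  simp

theorem Connection.comp_mem_coboundaries (D : Connection δ N) (E : Connection ε N')
    (f : N →ₗ[k] N') (hf : ∀ s m, f (D.op s m) = E.op s (f m)) (i : ℕ) :
    ∀ ω ∈ D.coboundaries i, f.compLeft _ ω ∈ E.coboundaries i := by
  intro ω hω
  cases i with
  | zero =>
    have h : ω = 0 := hω
    rw [h, map_zero]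
    exact Submodule.zero_mem _
  | succ i =>
    obtain ⟨η, rfl⟩ := hω
    exact ⟨f ∘ η, D.d_comp E f hf i η⟩

/-- The map on de Rham cohomology induced by applying, to every coefficient, a `k`-linear map `f`
that commutes with the operators `∂ₛ`. -/
def Connection.cohomologyMap (D : Connection δ N) (E : Connection ε N') (f : N →ₗ[k] N')
    (hf : ∀ s m, f (D.op s m) = E.op s (f m)) (i : ℕ) :
    D.Cohomology i →ₗ[k] E.Cohomology i :=
  Submodule.mapQ _ _ ((f.compLeft _).restrict (D.comp_mem_cocycles E f hf i))
    fun ω hω => D.comp_mem_coboundaries E f hf i ω.1 hω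

end DeRham

/-! ### `𝒟`-modules over the polynomial ring and their completions -/

section Poly

variable (n : ℕ) (k : Type*) [Field k]

/-- `R = k[x₁, …, xₙ]`. -/
abbrev Poly : Type _ := MvPolynomial (Fin n) k

/-- `R̂ = k[[x₁, …, xₙ]]`. -/
abbrev PSer : Type _ := MvPowerSeries (Fin n) k

/-- `𝒟 = 𝒟(R, k)`. -/
abbrev Diff : Type _ := DiffOp k (Poly n k)

/-- `𝒟` as a left `R`-module. -/
instance instModulePolyDiff : Module (Poly n k) (Diff n k) :=
  Module.compHom _ (mulOp k (Poly n k)).toRingHom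

variable {n}

/-- The element `∂ᵢ` of `𝒟`. -/
def del (i : Fin n) : Diff n k := derivOp (MvPolynomial.pderiv i)

variable {k}

theorem Poly.pderiv_comm (i j : Fin n) (f : Poly n k) :
    MvPolynomial.pderiv i (MvPolynomial.pderiv j f) =
      MvPolynomial.pderiv j (MvPolynomial.pderiv i f) := by
  have h : ⁅MvPolynomial.pderiv (R := k) i, MvPolynomial.pderiv (R := k) j⁆ = 0 := by
    refine MvPolynomial.derivation_ext fun l => ?_
    classical
    simp [Derivation.commutator_apply, MvPolynomial.pderiv_X, Pi.single_apply, apply_ite]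
  have := congrArg (fun D => D f) h
  simpa [Derivation.commutator_apply, sub_eq_zero] using this

theorem PSer.pderiv_comm (i j : Fin n) (f : PSer n k) :
    MvPowerSeries.pderiv k i (MvPowerSeries.pderiv k j f) =
      MvPowerSeries.pderiv k j (MvPowerSeries.pderiv k i f) := by
  rcases eq_or_ne i j with rfl | hij
  · rfl
  ext d
  simp only [MvPowerSeries.coeff_pderiv, Finsupp.add_apply, Finsupp.single_eq_of_ne hij,
    Finsupp.single_eq_of_ne hij.symm, add_zero]
  rw [add_right_comm]
  ring

variable (n k)
variable (M : Type*) [AddCommGroup M] [Module (Poly n k) M]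
  [Module (Diff n k) M] [IsScalarTower (Poly n k) (Diff n k) M]

theorem mulOp_smul (f : Poly n k) (m : M) : mulOp k (Poly n k) f • m = f • m := by
  have h : mulOp k (Poly n k) f = f • (1 : Diff n k) := (mul_one _).symm
  rw [h, smul_assoc, one_smul]

variable [Module k M] [IsScalarTower k (Poly n k) M]

/-- The operators `m ↦ ∂ᵢ • m` on a left `𝒟`-module `M`. -/
def conn : Connection (fun i : Fin n => MvPolynomial.pderiv (R := k) i) M where
  op i :=
    { toFun m := del k i • m
      map_add' := smul_add _
      map_smul' c m := by
        simp only [RingHom.id_apply]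
        rw [← algebraMap_smul (Poly n k) c m, ← algebraMap_smul (Poly n k) c (del k i • m),
          ← mulOp_smul, ← mulOp_smul, smul_smul, smul_smul, del, derivOp_mul_mulOp]
        simp }
  leibniz i f m := by
    change del k i • f • m = f • del k i • m + MvPolynomial.pderiv i f • m
    rw [← mulOp_smul, ← mulOp_smul, ← mulOp_smul, smul_smul, smul_smul, ← add_smul, del,
      derivOp_mul_mulOp]
  comm i j m := by
    change del k i • del k j • m = del k j • del k i • m
    rw [smul_smul, smul_smul, del, del, derivOp_comm (Poly.pderiv_comm i j)]

/-- The completion `M̂ = R̂ ⊗_R M`. -/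
abbrev Completion : Type _ := PSer n k ⊗[Poly n k] M

/-- `∂ᵢ (s ⊗ m) = ∂ᵢ(s) ⊗ m + s ⊗ ∂ᵢ m`, as an additive map on `M̂`. -/
def completionOpAux (i : Fin n) : Completion n k M →+ Completion n k M :=
  TensorProduct.liftAddHom
    { toFun s :=
        { toFun m := MvPowerSeries.pderiv k i s ⊗ₜ m + s ⊗ₜ (conn n k M).op i m
          map_zero' := by simp
          map_add' a b := by simp only [map_add, TensorProduct.tmul_add]; abel }
      map_zero' := by ext; simp
      map_add' s t := by
        ext m
        simp only [map_add, TensorProduct.add_tmul, AddMonoidHom.coe_mk, ZeroHom.coe_mk,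
          AddMonoidHom.add_apply]
        abel }
    (by
      intro f s m
      change MvPowerSeries.pderiv k i (f • s) ⊗ₜ m + (f • s) ⊗ₜ (conn n k M).op i m =
        MvPowerSeries.pderiv k i s ⊗ₜ (f • m) + s ⊗ₜ (conn n k M).op i (f • m)
      have h : MvPowerSeries.pderiv k i (f • s) =
          f • MvPowerSeries.pderiv k i s + MvPolynomial.pderiv i f • s := by
        rw [Algebra.smul_def, Algebra.smul_def, Algebra.smul_def,
          MvPowerSeries.algebraMap_apply', MvPowerSeries.algebraMap_apply']
        simp [MvPowerSeries.pderiv_coe, mul_comm, add_comm]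
      rw [h, (conn n k M).leibniz, TensorProduct.add_tmul, TensorProduct.tmul_add,
        TensorProduct.smul_tmul, TensorProduct.smul_tmul, TensorProduct.smul_tmul]
      abel)

theorem completionOpAux_tmul (i : Fin n) (s : PSer n k) (m : M) :
    completionOpAux n k M i (s ⊗ₜ m) =
      MvPowerSeries.pderiv k i s ⊗ₜ m + s ⊗ₜ (conn n k M).op i m := rfl

theorem completionOpAux_smul (i : Fin n) (a : PSer n k) (x : Completion n k M) :
    completionOpAux n k M i (a • x) =
      a • completionOpAux n k M i x + MvPowerSeries.pderiv k i a • x := by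
  induction x using TensorProduct.induction_on with
  | zero => simp
  | tmul s m =>
    rw [TensorProduct.smul_tmul', completionOpAux_tmul, completionOpAux_tmul, smul_add,
      TensorProduct.smul_tmul', TensorProduct.smul_tmul', TensorProduct.smul_tmul',
      smul_eq_mul, Derivation.leibniz, TensorProduct.add_tmul, smul_eq_mul, smul_eq_mul,
      smul_eq_mul, mul_comm s]
    abel
  | add x y hx hy => simp only [smul_add, map_add, hx, hy]; abel

/-- The operators `∂ᵢ` on `M̂ = R̂ ⊗_R M`, determined by
`∂ᵢ (s ⊗ m) = ∂ᵢ(s) ⊗ m + s ⊗ ∂ᵢ m`. -/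
def completionConn :
    Connection (fun i : Fin n => MvPowerSeries.pderiv k i) (Completion n k M) where
  op i :=
    { toFun := completionOpAux n k M i
      map_add' := map_add _
      map_smul' c x := by
        rw [← algebraMap_smul (PSer n k) c x, completionOpAux_smul, Derivation.map_algebraMap,
          zero_smul, add_zero, algebraMap_smul]
        rfl }
  leibniz i a x := completionOpAux_smul n k M i a x
  comm i j x := by
    change completionOpAux n k M i (completionOpAux n k M j x) =
      completionOpAux n k M j (completionOpAux n k M i x)
    induction x using TensorProduct.induction_on with
    | zero => simp
    | tmul s m =>
      simp only [completionOpAux_tmul, map_add]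
      rw [PSer.pderiv_comm i j, (conn n k M).comm i j]
      abel
    | add x y hx hy => simp only [map_add, hx, hy]

/-- The natural map `κ : M → R̂ ⊗_R M`, `m ↦ 1 ⊗ m`. -/
def kappa : M →ₗ[k] Completion n k M where
  toFun m := 1 ⊗ₜ m
  map_add' := TensorProduct.tmul_add _
  map_smul' c m := by
    simp only [RingHom.id_apply]
    rw [← algebraMap_smul (Poly n k) c m, TensorProduct.tmul_smul, algebraMap_smul]

theorem kappa_op (i : Fin n) (m : M) :
    kappa n k M ((conn n k M).op i m) = (completionConn n k M).op i (kappa n k M m) := by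
  change (1 : PSer n k) ⊗ₜ (conn n k M).op i m = completionOpAux n k M i (1 ⊗ₜ m)
  rw [completionOpAux_tmul]
  simp

/-- The de Rham cohomology `Hⁱ_dR(M)` of a left `𝒟`-module `M`. -/
abbrev HdR (i : ℕ) : Type _ := (conn n k M).Cohomology i

/-- The de Rham cohomology `Hⁱ_dR(R̂ ⊗_R M)` of the completion of a left `𝒟`-module `M`. -/
abbrev HdRCompletion (i : ℕ) : Type _ := (completionConn n k M).Cohomology i

/-- The completion map `κⁱ : Hⁱ_dR(M) → Hⁱ_dR(R̂ ⊗_R M)`, induced by `m ↦ 1 ⊗ m`. -/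
def kappaH (i : ℕ) : HdR n k M i →ₗ[k] HdRCompletion n k M i :=
  (conn n k M).cohomologyMap (completionConn n k M) (kappa n k M) (kappa_op n k M) i

variable {M}

/-- `M = ⨁_{l ∈ ℤ} 𝓜 l` is a grading making `M` a graded `𝒟`-module: `R_d 𝓜_l ⊆ 𝓜_{d + l}` for the
standard grading of `R`, and `∂ᵢ 𝓜_l ⊆ 𝓜_{l - 1}`. -/
structure IsGrading (𝓜 : ℤ → Submodule k M) : Prop where
  isInternal : DirectSum.IsInternal 𝓜
  smul_mem : ∀ (d : ℕ) (l : ℤ) (f : Poly n k) (m : M),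
    f ∈ MvPolynomial.homogeneousSubmodule (Fin n) k d → m ∈ 𝓜 l → f • m ∈ 𝓜 (d + l)
  del_smul_mem : ∀ (i : Fin n) (l : ℤ) (m : M), m ∈ 𝓜 l → del k i • m ∈ 𝓜 (l - 1)

end Poly

end DMod

end

/-! The completion is controlled degree by degree. An element of `R̂ ⊗ M` has a component in `M` for
every degree, `(s ⊗ x)_l = ∑ₑ s_{l-e} x_e` (`tensorComp`). Components commute with the `∂ᵢ` up to a
shift by one (`tensorComp_op`) and determine the element (`tensorComp_injective`). Conversely,
homogeneous elements of `M`, one in each degree, are the components of an element of `R̂ ⊗ M` as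
soon as they lie in one finitely generated homogeneous `R`-submodule (`exists_tensorComp_eq`).

Injectivity is then formal: if `κ ω = dη`, the components of `η` one degree above those of `ω` are
finitely many, and their sum is a primitive of `ω` over `M`.

For surjectivity, finite dimension confines the cohomology of `M` to a finite set `Λ` of degrees
(`finite_degrees`). The components of a cocycle over the completion are cocycles over `M`, exact
outside `Λ`. If their primitives can be assembled over the completion (`exists_coboundary`), the
cocycle is cohomologous to the sum of its components in `Λ`, which comes from `M`.

Assembling needs primitives in a single finitely generated `R`-submodule, which
`exists_bounded_primitive` supplies. Filter `M` by the `R`-modules `F_q` generated by the `∂^β g`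
with `|β| ≤ q`, for finitely many generators `g`. The associated graded module is finitely generated
over `R[ξ₁, …, ξₙ]`; its Koszul homology is Noetherian and, by Cartan's formula, killed by every
`ξₛ`, so it vanishes in high degrees. A form whose differential lies in `F_p` can therefore be moved
down the filtration, keeping its differential, to a step that does not depend on the form. That the
`F_q` exhaust `M` rests on `HasOrderLE.mem_adjoin`: in characteristic zero `R` and the `∂ᵢ` generate
`𝒟`. -/

noncomputable section

namespace DMod

/-! ### Cartan's formula and Koszul cycles and boundaries of symbols -/

section Koszul

variable {k A : Type*} [CommRing k] [CommRing A] [Algebra k A] {n : ℕ}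
  {δ : Fin n → Derivation k A A}
  {N : Type*} [AddCommGroup N] [Module k N] [Module A N]

/-- A form, extended by zero to a function on all sets of indices. -/
def Form.ext0 {i : ℕ} (ω : Form n N i) (S : Finset (Fin n)) : N :=
  if h : S.card = i then ω ⟨S, h⟩ else 0

theorem Form.ext0_of_card {i : ℕ} (ω : Form n N i) {S : Finset (Fin n)} (h : S.card = i) :
    ω.ext0 S = ω ⟨S, h⟩ := dif_pos h

theorem Form.ext0_mem {i : ℕ} {ω : Form n N i} {P : Submodule A N} (h : ∀ S, ω S ∈ P)
    (S : Finset (Fin n)) : ω.ext0 S ∈ P := by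
  unfold Form.ext0
  split_ifs
  · exact h _
  · exact P.zero_mem

theorem Connection.d_apply (D : Connection δ N) (i : ℕ) (ω : Form n N i)
    (T : {S : Finset (Fin n) // S.card = i + 1}) :
    D.d i ω T = ∑ s ∈ T.1, wedgeSign s T.1 • D.op s (Form.ext0 ω (T.1.erase s)) := by
  rw [← Finset.sum_coe_sort]
  refine Finset.sum_congr rfl fun s _ => ?_
  rw [Form.ext0_of_card]

theorem wedgeSign_mul_self (s : Fin n) (T : Finset (Fin n)) :
    wedgeSign s T * wedgeSign s T = 1 := by
  rw [wedgeSign, ← mul_pow]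
  simp

/-- Contraction with the vector field `∂ₛ`. -/
def contract (s : Fin n) {i : ℕ} (ω : Form n N (i + 1)) : Form n N i := fun T =>
  if s ∈ T.1 then 0 else wedgeSign s (insert s T.1) • Form.ext0 ω (insert s T.1)

theorem contract_mem (s : Fin n) {i : ℕ} {ω : Form n N (i + 1)} {P : Submodule A N}
    (h : ∀ S, ω S ∈ P) (S) : contract s ω S ∈ P := by
  unfold contract
  split_ifs
  · exact P.zero_mem
  · exact zsmul_mem (Form.ext0_mem h _) _

theorem contract_ext0 (s : Fin n) {i : ℕ} (ω : Form n N (i + 1)) {T : Finset (Fin n)}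
    (hT : T.card = i) :
    (contract s ω).ext0 T =
      if s ∈ T then 0 else wedgeSign s (insert s T) • Form.ext0 ω (insert s T) := by
  rw [Form.ext0_of_card _ hT]
  rfl

/-- The part of `ιₛ d ω` shared by all degrees. -/
theorem Connection.contract_d (D : Connection δ N) (s : Fin n) {i : ℕ} (ω : Form n N i)
    (T : {S : Finset (Fin n) // S.card = i}) (hs : s ∉ T.1) :
    contract s (D.d i ω) T = D.op s (ω T) + ∑ t ∈ T.1,
      (wedgeSign s (insert s T.1) * wedgeSign t (insert s T.1)) •
        D.op t (Form.ext0 ω ((insert s T.1).erase t)) := by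
  have hc : (insert s T.1).card = i + 1 := by rw [Finset.card_insert_of_notMem hs, T.2]
  rw [contract, if_neg hs, Form.ext0_of_card _ hc, D.d_apply, Finset.sum_insert hs, smul_add,
    smul_smul, wedgeSign_mul_self, one_smul, Finset.smul_sum]
  simp only [Finset.erase_insert hs, smul_smul]
  rw [Form.ext0_of_card ω T.2]

/-- Lowest case of Cartan's formula, where the term `d ιₛ` is absent. -/
theorem Connection.cartan_zero (D : Connection δ N) (s : Fin n) (ω : Form n N 0) (T) :
    D.op s (ω T) = contract s (D.d 0 ω) T := by
  have hT : T.1 = ∅ := Finset.card_eq_zero.mp T.2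
  rw [D.contract_d s ω T (by simp [hT])]
  simp [hT]

/-- Cartan's formula `L = ι d + d ι` for the constant vector field `∂ₛ`, whose Lie derivative acts
on coefficients only. If `s ∈ T`, only the summand `t = s` of `d ι` survives; otherwise the summands
for `t ∈ T` cancel because `dxₛ` and `dxₜ` anticommute. -/
theorem Connection.cartan (D : Connection δ N) (s : Fin n) {i : ℕ} (ω : Form n N (i + 1)) (T) :
    D.op s (ω T) = contract s (D.d (i + 1) ω) T + D.d i (contract s ω) T := by
  have herase : ∀ t ∈ T.1, (T.1.erase t).card = i := fun t ht => by
    rw [Finset.card_erase_of_mem ht, T.2]; rfl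
  rw [D.d_apply]
  by_cases hs : s ∈ T.1
  · rw [contract, if_pos hs, zero_add, Finset.sum_eq_single_of_mem s hs]
    · rw [contract_ext0 _ _ (herase s hs), if_neg (Finset.notMem_erase _ _),
        Finset.insert_erase hs, Form.ext0_of_card ω T.2, map_zsmul, smul_smul, wedgeSign_mul_self,
        one_smul]
    · intro t ht hts
      rw [contract_ext0 _ _ (herase t ht), if_pos (Finset.mem_erase.mpr ⟨hts.symm, hs⟩)]
      simp
  · rw [D.contract_d s ω T hs, add_assoc, ← Finset.sum_add_distrib, Finset.sum_eq_zero, add_zero]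
    intro t ht
    have hts : s ≠ t := fun h => hs (h ▸ ht)
    rw [contract_ext0 _ _ (herase t ht), if_neg (fun h => hs (Finset.mem_of_mem_erase h)),
      map_zsmul, smul_smul, ← Finset.erase_insert_of_ne hts, ← add_smul]
    have key := wedgeSign_swap (Finset.mem_insert_self s T.1) (Finset.mem_insert_of_mem ht) hts
    rw [Finset.erase_insert hs] at key
    have h1 := wedgeSign_mul_self s (insert s T.1)
    have h2 := wedgeSign_mul_self s ((insert s T.1).erase t)
    have : wedgeSign s (insert s T.1) * wedgeSign t (insert s T.1) +
        wedgeSign t T.1 * wedgeSign s ((insert s T.1).erase t) = 0 := by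
      -- Multiply `key` by the two signs at `s`; their squares are 1.
      linear_combination (wedgeSign s (insert s T.1) * wedgeSign s ((insert s T.1).erase t)) * key
        - (wedgeSign s (insert s T.1) * wedgeSign t (insert s T.1)) * h2
        - (wedgeSign t T.1 * wedgeSign s ((insert s T.1).erase t)) * h1
    rw [this, zero_smul]

theorem Connection.d_mem (D : Connection δ N) {P Q : Submodule A N}
    (hPQ : ∀ s, ∀ m ∈ P, D.op s m ∈ Q) {i : ℕ} {ω : Form n N i} (hω : ∀ S, ω S ∈ P) (T) :
    D.d i ω T ∈ Q := by
  rw [D.d_apply]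
  exact Q.sum_mem fun s _ => zsmul_mem (hPQ s _ (Form.ext0_mem hω _)) _

/-- By Leibniz the difference involves only multiples of the coefficients of `ω` by derivatives of
`a`. So `d` is `A`-linear on symbols. -/
theorem Connection.d_smul_sub_mem (D : Connection δ N) {P : Submodule A N} (a : A)
    {i : ℕ} {ω : Form n N i} (hω : ∀ S, ω S ∈ P) (T) :
    D.d i (a • ω) T - a • D.d i ω T ∈ P := by
  rw [D.d_apply, D.d_apply, Finset.smul_sum, ← Finset.sum_sub_distrib]
  refine P.sum_mem fun s _ => ?_
  have h : Form.ext0 (a • ω) (T.1.erase s) = a • Form.ext0 ω (T.1.erase s) := by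
    unfold Form.ext0
    split_ifs <;> simp
  rw [h, D.leibniz, smul_comm a, ← smul_sub, add_sub_cancel_left]
  exact zsmul_mem (P.smul_mem _ (Form.ext0_mem hω _)) _

/-- Forms with coefficients in `P` whose differential also has coefficients in `P`: the symbols of
such forms are the cycles of the Koszul complex. -/
def Connection.symbolCycles (D : Connection δ N) (P : Submodule A N) (i : ℕ) :
    Submodule A (Form n N i) where
  carrier := {η | (∀ S, η S ∈ P) ∧ ∀ T, D.d i η T ∈ P}
  zero_mem' := by simp
  add_mem' {a b} ha hb := ⟨fun S => P.add_mem (ha.1 S) (hb.1 S), fun T => by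
    rw [map_add]; exact P.add_mem (ha.2 T) (hb.2 T)⟩
  smul_mem' c a ha := ⟨fun S => P.smul_mem c (ha.1 S), fun T => by
    have h := P.add_mem (D.d_smul_sub_mem c ha.1 T) (P.smul_mem c (ha.2 T))
    rwa [sub_add_cancel] at h⟩

/-- Forms that agree, up to coefficients in `P`, with the differential of a form with coefficients
in `P`: the symbols of such forms are the boundaries of the Koszul complex. -/
def Connection.symbolBoundaries (D : Connection δ N) (P : Submodule A N) :
    (i : ℕ) → Submodule A (Form n N i)
  | 0 =>
    { carrier := {η | ∀ S, η S ∈ P}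
      zero_mem' := by simp
      add_mem' := fun ha hb S => P.add_mem (ha S) (hb S)
      smul_mem' := fun c _ ha S => P.smul_mem c (ha S) }
  | i + 1 =>
    { carrier := {η | ∃ θ : Form n N i, (∀ S, θ S ∈ P) ∧ ∀ T, η T - D.d i θ T ∈ P}
      zero_mem' := ⟨0, by simp, by simp⟩
      add_mem' := by
        rintro a b ⟨θ, h, h'⟩ ⟨ξ, g, g'⟩
        refine ⟨θ + ξ, fun S => P.add_mem (h S) (g S), fun T => ?_⟩
        rw [map_add]
        simpa [add_sub_add_comm] using P.add_mem (h' T) (g' T)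
      smul_mem' := by
        rintro c a ⟨θ, h, h'⟩
        refine ⟨c • θ, fun S => P.smul_mem c (h S), fun T => ?_⟩
        have := P.sub_mem (P.smul_mem c (h' T)) (D.d_smul_sub_mem c h T)
        rw [smul_sub, sub_sub, add_sub_cancel] at this
        exact this }

theorem Connection.mem_symbolBoundaries (D : Connection δ N) {P : Submodule A N} {i : ℕ}
    {η : Form n N i} (h : ∀ S, η S ∈ P) : η ∈ D.symbolBoundaries P i := by
  cases i with
  | zero => exact h
  | succ i => exact ⟨0, by simp, by simpa using h⟩

/-- A symbol boundary can be changed, without changing its differential, to have coefficients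
in `P`. -/
theorem Connection.exists_d_eq_of_mem_symbolBoundaries (D : Connection δ N) {P : Submodule A N}
    {i : ℕ} {η : Form n N i} (h : η ∈ D.symbolBoundaries P i) :
    ∃ η' : Form n N i, (∀ S, η' S ∈ P) ∧ D.d i η' = D.d i η := by
  cases i with
  | zero => exact ⟨η, h, rfl⟩
  | succ i =>
    obtain ⟨θ, -, h'⟩ := h
    exact ⟨η - D.d i θ, h', by rw [map_sub, D.d_d, sub_zero]⟩

/-- This is `d ∘ d = 0` on symbols; `P` and `Q` stand for consecutive steps of the filtration. -/
theorem Connection.symbolBoundaries_le_symbolCycles (D : Connection δ N) {P Q : Submodule A N}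
    (hle : P ≤ Q) (hPQ : ∀ s, ∀ m ∈ P, D.op s m ∈ Q) (i : ℕ) :
    D.symbolBoundaries P i ≤ D.symbolCycles Q i := by
  intro η h
  have h1 : ∀ S, η S ∈ Q := by
    cases i with
    | zero => exact fun S => hle (h S)
    | succ i =>
      obtain ⟨θ, hθ, h'⟩ := h
      intro S
      have := Q.add_mem (hle (h' S)) (D.d_mem hPQ hθ S)
      rwa [sub_add_cancel] at this
  obtain ⟨η', h2, h3⟩ := D.exists_d_eq_of_mem_symbolBoundaries h
  exact ⟨h1, fun T => h3 ▸ D.d_mem hPQ h2 T⟩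

/-- The operators `∂ₛ` act by zero on Koszul homology. -/
theorem Connection.op_mem_symbolBoundaries (D : Connection δ N) {P : Submodule A N} (s : Fin n)
    {i : ℕ} {η : Form n N i} (h : η ∈ D.symbolCycles P i) :
    (fun S => D.op s (η S)) ∈ D.symbolBoundaries P i := by
  cases i with
  | zero =>
    intro S
    simp only [D.cartan_zero]
    exact contract_mem s h.2 S
  | succ i =>
    refine ⟨contract s η, contract_mem s h.1, fun T => ?_⟩
    simp only [D.cartan, add_sub_cancel_right]
    exact contract_mem s h.2 T

end Koszul

/-! ### The order filtration and bounded primitives -/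

section Filtration

variable {k A : Type*} [CommRing k] [CommRing A] [Algebra k A] {n : ℕ}
  {δ : Fin n → Derivation k A A}
  {N : Type*} [AddCommGroup N] [Module k N] [Module A N]

/-- The `A`-submodule generated by all `∂^β m` with `m ∈ V` and `|β| ≤ q`. -/
def Connection.fil (D : Connection δ N) (V : Submodule A N) : ℕ → Submodule A N
  | 0 => V
  | q + 1 => D.fil V q ⊔ Submodule.span A {x | ∃ s, ∃ m ∈ D.fil V q, D.op s m = x}

theorem Connection.fil_le_succ (D : Connection δ N) (V : Submodule A N) (q : ℕ) :
    D.fil V q ≤ D.fil V (q + 1) := le_sup_left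

theorem Connection.fil_mono (D : Connection δ N) (V : Submodule A N) : Monotone (D.fil V) :=
  monotone_nat_of_le_succ (D.fil_le_succ V)

theorem Connection.op_mem_fil (D : Connection δ N) (V : Submodule A N) (q : ℕ) (s : Fin n) (m : N)
    (hm : m ∈ D.fil V q) : D.op s m ∈ D.fil V (q + 1) :=
  (le_sup_right : _ ≤ D.fil V (q + 1)) (Submodule.subset_span ⟨s, m, hm, rfl⟩)

open scoped IsMulCommutative in
/-- The action on `N` of polynomials with constant coefficients in the commuting operators `∂ₛ`. -/
theorem Connection.exists_op_monomial (D : Connection δ N) :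
    ∃ E : (Fin n →₀ ℕ) → Module.End k N, E 0 = 1 ∧
      ∀ β s, E (Finsupp.single s 1 + β) = D.op s * E β := by
  have hcomm : ∀ a ∈ Set.range D.op, ∀ b ∈ Set.range D.op, a * b = b * a := by
    rintro _ ⟨i, rfl⟩ _ ⟨j, rfl⟩
    exact LinearMap.ext fun m => D.comm i j m
  have := Algebra.isMulCommutative_adjoin k hcomm
  -- `aeval` needs a commutative target, hence the subalgebra generated by the `∂ₛ`.
  let φ : MvPolynomial (Fin n) k →ₐ[k] Algebra.adjoin k (Set.range D.op) :=
    MvPolynomial.aeval fun s => ⟨D.op s, Algebra.subset_adjoin ⟨s, rfl⟩⟩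
  refine ⟨fun β => (φ (MvPolynomial.monomial β 1)).1, ?_, fun β s => ?_⟩
  · change (φ 1).1 = 1
    rw [map_one]
    rfl
  · have h : MvPolynomial.monomial (Finsupp.single s 1 + β) (1 : k) =
        MvPolynomial.X s * MvPolynomial.monomial β 1 := by
      rw [MvPolynomial.X, MvPolynomial.monomial_mul, one_mul]
    simp only [h, map_mul]
    change (φ (MvPolynomial.X s)).1 * _ = _
    rw [MvPolynomial.aeval_X]

/-- The monomial `∂^β`. -/
def Connection.opMonomial (D : Connection δ N) : (Fin n →₀ ℕ) → Module.End k N :=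
  D.exists_op_monomial.choose

theorem Connection.opMonomial_zero (D : Connection δ N) : D.opMonomial 0 = 1 :=
  D.exists_op_monomial.choose_spec.1

theorem Connection.opMonomial_single_add (D : Connection δ N) (β : Fin n →₀ ℕ) (s : Fin n) :
    D.opMonomial (Finsupp.single s 1 + β) = D.op s * D.opMonomial β :=
  D.exists_op_monomial.choose_spec.2 β s

theorem Connection.opMonomial_mem_fil (D : Connection δ N) {V : Submodule A N} {g : N}
    (hg : g ∈ V) (q : ℕ) (β : Fin n →₀ ℕ) (hβ : β.degree = q) :
    D.opMonomial β g ∈ D.fil V q := by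
  induction q generalizing β with
  | zero =>
    rw [Finsupp.degree_eq_zero_iff] at hβ
    rw [hβ, D.opMonomial_zero]
    exact hg
  | succ q ih =>
    obtain ⟨s, hs⟩ : ∃ s, β s ≠ 0 := by
      by_contra! h
      have : β = 0 := Finsupp.ext h
      simp [this] at hβ
    have hle : Finsupp.single s 1 ≤ β := by
      rw [Finsupp.single_le_iff]; omega
    obtain ⟨γ, rfl⟩ := exists_add_of_le hle
    rw [D.opMonomial_single_add]
    refine D.op_mem_fil V q s _ (ih γ ?_)
    rw [map_add, Finsupp.degree_single] at hβ
    omega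

/-- The `A`-linear map `f ξ^β ↦ f ∂^β g`. -/
def Connection.symbolMap (D : Connection δ N) (g : N) : MvPolynomial (Fin n) A →ₗ[A] N :=
  (MvPolynomial.basisMonomials (Fin n) A).constr A fun β => D.opMonomial β g

theorem Connection.symbolMap_monomial (D : Connection δ N) (g : N) (β : Fin n →₀ ℕ) (a : A) :
    D.symbolMap g (MvPolynomial.monomial β a) = a • D.opMonomial β g := by
  have h : MvPolynomial.monomial β a = a • MvPolynomial.basisMonomials (Fin n) A β := by
    simp [MvPolynomial.smul_monomial]
  rw [h, map_smul, symbolMap, Module.Basis.constr_basis]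

/-- Moving `∂ₛ` past a coefficient `f` costs `δₛ(f)`, a term with one `∂` fewer. So multiplication
by `ξₛ` represents `∂ₛ` modulo lower order. -/
theorem Connection.symbolMap_X_mul_sub_mem_fil (D : Connection δ N) {V : Submodule A N} {g : N}
    (hg : g ∈ V) {q : ℕ} {u : MvPolynomial (Fin n) A} (hu : u.IsHomogeneous q) (s : Fin n) :
    D.symbolMap g (MvPolynomial.X s * u) - D.op s (D.symbolMap g u) ∈ D.fil V q := by
  rw [u.as_sum, Finset.mul_sum, map_sum, map_sum, map_sum, ← Finset.sum_sub_distrib]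
  refine Submodule.sum_mem _ fun β hβ => ?_
  rw [MvPolynomial.X, MvPolynomial.monomial_mul, one_mul, D.symbolMap_monomial,
    D.symbolMap_monomial, D.leibniz, D.opMonomial_single_add, Module.End.mul_apply,
    sub_add_cancel_left]
  refine Submodule.neg_mem _ (Submodule.smul_mem _ _ (D.opMonomial_mem_fil hg q β ?_))
  rw [Finsupp.degree_eq_weight_one]
  exact hu (MvPolynomial.mem_support_iff.mp hβ)

theorem homogeneousComponent_succ_X_mul (s : Fin n) (q : ℕ) (u : MvPolynomial (Fin n) A) :
    MvPolynomial.homogeneousComponent (q + 1) (MvPolynomial.X s * u) =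
      MvPolynomial.X s * MvPolynomial.homogeneousComponent q u := by
  classical
  ext β
  rw [MvPolynomial.coeff_homogeneousComponent, MvPolynomial.coeff_X_mul', MvPolynomial.coeff_X_mul',
    MvPolynomial.coeff_homogeneousComponent]
  by_cases hs : s ∈ β.support
  · have hle : Finsupp.single s 1 ≤ β := by
      rw [Finsupp.single_le_iff]
      have := Finsupp.mem_support_iff.mp hs
      omega
    obtain ⟨γ, rfl⟩ := exists_add_of_le hle
    simp only [if_pos hs, add_tsub_cancel_left, map_add, Finsupp.degree_single]
    simp [add_comm 1]
  · simp [hs]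

theorem homogeneousComponent_zero_X_mul (s : Fin n) (u : MvPolynomial (Fin n) A) :
    MvPolynomial.homogeneousComponent 0 (MvPolynomial.X s * u) = 0 := by
  classical
  simp [MvPolynomial.homogeneousComponent_zero, MvPolynomial.coeff_X_mul']

variable {ι : Type*} [Fintype ι]

/-- The degree `q` part of the symbol map, on forms. -/
def Connection.formSymbol (D : Connection δ N) (g : ι → N) (i q : ℕ) :
    ({S : Finset (Fin n) // S.card = i} × ι → MvPolynomial (Fin n) A) →ₗ[A] Form n N i :=
  LinearMap.pi fun S => ∑ a, D.symbolMap (g a) ∘ₗ MvPolynomial.homogeneousComponent q ∘ₗ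
    LinearMap.proj (S, a)

theorem Connection.formSymbol_apply (D : Connection δ N) (g : ι → N) (i q : ℕ)
    (u : {S : Finset (Fin n) // S.card = i} × ι → MvPolynomial (Fin n) A) (S) :
    D.formSymbol g i q u S =
      ∑ a, D.symbolMap (g a) (MvPolynomial.homogeneousComponent q (u (S, a))) := by
  simp [formSymbol]

theorem Connection.formSymbol_zero_X_smul (D : Connection δ N) (g : ι → N) (i : ℕ)
    (u : {S : Finset (Fin n) // S.card = i} × ι → MvPolynomial (Fin n) A) (s : Fin n) :
    D.formSymbol g i 0 ((MvPolynomial.X s : MvPolynomial (Fin n) A) • u) = 0 := by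
  funext S
  rw [D.formSymbol_apply]
  refine Finset.sum_eq_zero fun a _ => ?_
  rw [Pi.smul_apply, smul_eq_mul, homogeneousComponent_zero_X_mul, map_zero]

theorem Connection.formSymbol_succ_X_smul (D : Connection δ N) (g : ι → N) (i q : ℕ)
    (u : {S : Finset (Fin n) // S.card = i} × ι → MvPolynomial (Fin n) A) (s : Fin n) (S) :
    D.formSymbol g i (q + 1) ((MvPolynomial.X s : MvPolynomial (Fin n) A) • u) S -
      D.op s (D.formSymbol g i q u S) ∈ D.fil (Submodule.span A (Set.range g)) q := by
  simp only [D.formSymbol_apply, Pi.smul_apply, smul_eq_mul, homogeneousComponent_succ_X_mul,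
    map_sum]
  rw [← Finset.sum_sub_distrib]
  exact Submodule.sum_mem _ fun a _ => D.symbolMap_X_mul_sub_mem_fil
    (Submodule.subset_span (Set.mem_range_self a))
    (MvPolynomial.homogeneousComponent_isHomogeneous _ _) s

/-- Every element of the `q`-th step is, up to the previous step, given by a symbol of
degree `q`. -/
theorem Connection.exists_symbol (D : Connection δ N) (g : ι → N) (q : ℕ) (m : N)
    (hm : m ∈ D.fil (Submodule.span A (Set.range g)) (q + 1)) :
    ∃ u : ι → MvPolynomial (Fin n) A, (∀ a, (u a).IsHomogeneous (q + 1)) ∧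
      m - ∑ a, D.symbolMap (g a) (u a) ∈ D.fil (Submodule.span A (Set.range g)) q := by
  set V := Submodule.span A (Set.range g)
  have hg : ∀ a, g a ∈ V := fun a => Submodule.subset_span ⟨a, rfl⟩
  -- the elements of the form wanted are an `A`-submodule
  let W (q : ℕ) : Submodule A N :=
    { carrier := {m | ∃ u : ι → MvPolynomial (Fin n) A, (∀ a, (u a).IsHomogeneous (q + 1)) ∧
        m - ∑ a, D.symbolMap (g a) (u a) ∈ D.fil V q}
      zero_mem' := ⟨0, fun a => MvPolynomial.isHomogeneous_zero _ _ _, by simp⟩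
      add_mem' := by
        rintro x y ⟨u, hu, hx⟩ ⟨v, hv, hy⟩
        refine ⟨u + v, fun a => (hu a).add (hv a), ?_⟩
        simp only [Pi.add_apply, map_add, Finset.sum_add_distrib, add_sub_add_comm]
        exact Submodule.add_mem _ hx hy
      smul_mem' := by
        rintro c x ⟨u, hu, hx⟩
        refine ⟨c • u, fun a => ?_, ?_⟩
        · rw [Pi.smul_apply, MvPolynomial.smul_eq_C_mul]
          simpa using (MvPolynomial.isHomogeneous_C (Fin n) c).mul (hu a)
        · simp only [Pi.smul_apply, map_smul, ← Finset.smul_sum, ← smul_sub]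
          exact Submodule.smul_mem _ _ hx }
  have hW : ∀ q, D.fil V q ≤ W q := fun q m hm =>
    ⟨0, fun a => MvPolynomial.isHomogeneous_zero _ _ _, by simpa using hm⟩
  -- The condition bears on `∂ₛ` of the remainder instead of placing the remainder in step `q - 1`,
  -- so that `q = 0`, where the remainder is zero, is covered too.
  have step : ∀ q, (∀ m ∈ D.fil V q, ∃ u : ι → MvPolynomial (Fin n) A,
      (∀ a, (u a).IsHomogeneous q) ∧ ∀ s, D.op s (m - ∑ a, D.symbolMap (g a) (u a)) ∈ D.fil V q) →
      D.fil V (q + 1) ≤ W q := by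
    intro q h
    refine sup_le (hW q) (Submodule.span_le.mpr ?_)
    rintro _ ⟨s, m, hm, rfl⟩
    obtain ⟨u, hu, hms⟩ := h m hm
    refine ⟨fun a => MvPolynomial.X s * u a, fun a => ?_, ?_⟩
    · rw [add_comm]
      exact (MvPolynomial.isHomogeneous_X A s).mul (hu a)
    · have h2 : ∑ a, (D.symbolMap (g a) (MvPolynomial.X s * u a) -
          D.op s (D.symbolMap (g a) (u a))) ∈ D.fil V q :=
        Submodule.sum_mem _ fun a _ => D.symbolMap_X_mul_sub_mem_fil (hg a) (hu a) s
      have h3 := Submodule.sub_mem _ (hms s) h2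
      rw [map_sub, map_sum, Finset.sum_sub_distrib, sub_sub, add_sub_cancel] at h3
      exact h3
  suffices h : D.fil V (q + 1) ≤ W q from h hm
  clear hm m
  induction q with
  | zero =>
    refine step 0 fun m hm => ?_
    obtain ⟨c, rfl⟩ := (Submodule.mem_span_range_iff_exists_fun A).mp hm
    refine ⟨fun a => MvPolynomial.C (c a), fun a => MvPolynomial.isHomogeneous_C _ _, fun s => ?_⟩
    have h : ∀ a, D.symbolMap (g a) (MvPolynomial.C (c a)) = c a • g a := fun a => by
      rw [← MvPolynomial.monomial_zero', D.symbolMap_monomial, D.opMonomial_zero]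
      rfl
    simp [h]
  | succ q ih =>
    refine step (q + 1) fun m hm => ?_
    obtain ⟨u, hu, h⟩ := ih hm
    exact ⟨u, hu, fun s => D.op_mem_fil V q s _ h⟩

variable [IsNoetherianRing A]

/-- The Koszul homology of the associated graded module vanishes in high degrees: it is
finitely generated, and the symbols of the `∂ₛ` act by zero on it. -/
theorem Connection.symbolCycles_le_symbolBoundaries (D : Connection δ N) (g : ι → N) (i : ℕ) :
    ∃ q₀, ∀ q ≥ q₀, D.symbolCycles (D.fil (Submodule.span A (Set.range g)) (q + 1)) i ≤
      D.symbolBoundaries (D.fil (Submodule.span A (Set.range g)) q) i := by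
  set V := Submodule.span A (Set.range g)
  have hBZ : ∀ q, D.symbolBoundaries (D.fil V q) i ≤ D.symbolCycles (D.fil V (q + 1)) i := fun q =>
    D.symbolBoundaries_le_symbolCycles (D.fil_le_succ V q) (D.op_mem_fil V q) i
  -- `ξₛ` acts as `∂ₛ` up to lower order, and `∂ₛ` is null-homotopic by Cartan's formula: cycles go
  -- to boundaries.
  have hX : ∀ q s u, D.formSymbol g i q u ∈ D.symbolCycles (D.fil V q) i →
      D.formSymbol g i (q + 1) ((MvPolynomial.X s : MvPolynomial (Fin n) A) • u) ∈
        D.symbolBoundaries (D.fil V q) i := by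
    intro q s u hu
    have := Submodule.add_mem _
      (D.mem_symbolBoundaries fun S => D.formSymbol_succ_X_smul g i q u s S)
      (D.op_mem_symbolBoundaries s hu)
    convert this using 1
    funext S
    simp
  -- Symbols whose graded pieces are all cycles, those of degree above `q` being boundaries. By `hX`
  -- this is stable under the `ξₛ`; it grows with `q`, so it stabilizes since `A[ξ]` is Noetherian.
  let T (q : ℕ) : Submodule (MvPolynomial (Fin n) A)
      ({S : Finset (Fin n) // S.card = i} × ι → MvPolynomial (Fin n) A) :=
    { carrier := {u | (∀ p, D.formSymbol g i p u ∈ D.symbolCycles (D.fil V p) i) ∧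
        ∀ p ≥ q, D.formSymbol g i (p + 1) u ∈ D.symbolBoundaries (D.fil V p) i}
      zero_mem' := ⟨fun p => by rw [map_zero]; exact Submodule.zero_mem _,
        fun p _ => by rw [map_zero]; exact Submodule.zero_mem _⟩
      add_mem' := fun ha hb =>
        ⟨fun p => by rw [map_add]; exact Submodule.add_mem _ (ha.1 p) (hb.1 p),
          fun p hp => by rw [map_add]; exact Submodule.add_mem _ (ha.2 p hp) (hb.2 p hp)⟩
      smul_mem' := by
        intro f u hu
        induction f using MvPolynomial.induction_on generalizing u with
        | C a =>
          have h : (MvPolynomial.C a : MvPolynomial (Fin n) A) • u = a • u := by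
            funext S
            simp [MvPolynomial.smul_eq_C_mul]
          rw [h]
          exact ⟨fun p => by rw [map_smul]; exact Submodule.smul_mem _ _ (hu.1 p),
            fun p hp => by rw [map_smul]; exact Submodule.smul_mem _ _ (hu.2 p hp)⟩
        | add f f' h h' =>
          rw [add_smul]
          exact ⟨fun p => by rw [map_add]; exact Submodule.add_mem _ ((h hu).1 p) ((h' hu).1 p),
            fun p hp => by
              rw [map_add]; exact Submodule.add_mem _ ((h hu).2 p hp) ((h' hu).2 p hp)⟩
        | mul_X f s h =>
          rw [mul_smul]
          refine h ⟨fun p => ?_, fun p hp => hX p s u (hu.1 p)⟩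
          cases p with
          | zero => rw [D.formSymbol_zero_X_smul]; exact Submodule.zero_mem _
          | succ p => exact hBZ p (hX p s u (hu.1 p)) }
  have hT : Monotone T := fun q q' hqq' u hu => ⟨hu.1, fun p hp => hu.2 p (hqq'.trans hp)⟩
  obtain ⟨q₀, hq₀⟩ := monotone_stabilizes_iff_noetherian.mpr
    (inferInstance : IsNoetherian (MvPolynomial (Fin n) A)
      ({S : Finset (Fin n) // S.card = i} × ι → MvPolynomial (Fin n) A)) ⟨T, hT⟩
  refine ⟨q₀, fun q hq η hη => ?_⟩
  choose u hu hu' using fun S => D.exists_symbol g q (η S) (hη.1 S)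
  have hself : D.formSymbol g i (q + 1) (fun x => u x.1 x.2) = fun S =>
      ∑ a, D.symbolMap (g a) (u S a) := by
    funext S
    rw [D.formSymbol_apply]
    refine Finset.sum_congr rfl fun a _ => ?_
    rw [MvPolynomial.homogeneousComponent_of_mem (hu S a), if_pos rfl]
  have hother : ∀ p ≠ q + 1, D.formSymbol g i p (fun x => u x.1 x.2) = 0 := by
    intro p hp
    funext S
    rw [D.formSymbol_apply]
    refine Finset.sum_eq_zero fun a _ => ?_
    rw [MvPolynomial.homogeneousComponent_of_mem (hu S a), if_neg hp, map_zero]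
  have hdiff : η - D.formSymbol g i (q + 1) (fun x => u x.1 x.2) ∈
      D.symbolBoundaries (D.fil V q) i :=
    D.mem_symbolBoundaries (by rw [hself]; exact hu')
  -- A homogeneous symbol of degree `q + 1` has no piece above that degree, so the boundary
  -- condition is trivial here. Membership in `T q₀`, the same module, then says that its own piece
  -- is a boundary.
  have hmem : (fun x => u x.1 x.2) ∈ T (q + 1) := by
    refine ⟨fun p => ?_, fun p hp => ?_⟩
    · rcases eq_or_ne p (q + 1) with rfl | hp
      · have := Submodule.sub_mem _ hη (hBZ q hdiff)
        rwa [sub_sub_cancel] at this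
      · rw [hother p hp]; exact Submodule.zero_mem _
    · rw [hother (p + 1) (by omega)]; exact Submodule.zero_mem _
  have heq : T q₀ = T (q + 1) := hq₀ (q + 1) (by omega)
  rw [← heq] at hmem
  have := Submodule.add_mem _ hdiff (hmem.2 q hq)
  rwa [sub_add_cancel] at this

/-- Exact forms with coefficients in a given step of the filtration have primitives with
coefficients in a step depending on the former only. -/
theorem Connection.exists_bounded_primitive (D : Connection δ N) (g : ι → N)
    (hg : ∀ m, ∃ q, m ∈ D.fil (Submodule.span A (Set.range g)) q) (i p : ℕ) :
    ∃ q, ∀ η : Form n N i, (∀ T, D.d i η T ∈ D.fil (Submodule.span A (Set.range g)) p) →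
      ∃ η' : Form n N i, (∀ S, η' S ∈ D.fil (Submodule.span A (Set.range g)) q) ∧
        D.d i η' = D.d i η := by
  obtain ⟨q₀, hq₀⟩ := D.symbolCycles_le_symbolBoundaries g i
  set V := Submodule.span A (Set.range g)
  -- Above `p` the differential stays in every step passed through; above `q₀` Koszul cycles are
  -- boundaries. Both are needed to descend by one step.
  refine ⟨max p q₀, fun η hη => ?_⟩
  have descend : ∀ r, ∀ η : Form n N i, (∀ T, D.d i η T ∈ D.fil V p) →
      (∀ S, η S ∈ D.fil V (max p q₀ + r)) →
      ∃ η' : Form n N i, (∀ S, η' S ∈ D.fil V (max p q₀)) ∧ D.d i η' = D.d i η := by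
    intro r
    induction r with
    | zero => exact fun η _ h => ⟨η, h, rfl⟩
    | succ r ih =>
      intro η hd h
      have hZ : η ∈ D.symbolCycles (D.fil V (max p q₀ + r + 1)) i :=
        ⟨h, fun T => D.fil_mono V (by omega) (hd T)⟩
      obtain ⟨η₁, h₁, hd₁⟩ := D.exists_d_eq_of_mem_symbolBoundaries (hq₀ _ (by omega) hZ)
      obtain ⟨η₂, h₂, hd₂⟩ := ih η₁ (hd₁ ▸ hd) h₁
      exact ⟨η₂, h₂, hd₂.trans hd₁⟩
  choose e he using fun S => hg (η S)
  refine descend (∑ S, e S) η hη fun S => D.fil_mono V ?_ (he S)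
  exact (Finset.single_le_sum (f := e) (fun _ _ => Nat.zero_le _) (Finset.mem_univ S)).trans
    (Nat.le_add_left _ _)

end Filtration

/-! ### Homogeneous parts of power series -/

section HomogeneousParts

variable {n : ℕ} {k : Type*} [Field k]

theorem poly_smul_eq (f : Poly n k) (s : PSer n k) : f • s = (f : PSer n k) * s := by
  rw [Algebra.smul_def, MvPowerSeries.algebraMap_apply', Algebra.algebraMap_self,
    MvPowerSeries.map_id]
  rfl

/-- The homogeneous part of degree `j` of a power series, as a polynomial; zero for `j < 0`. -/
def homPart (j : ℤ) : PSer n k →+ Poly n k where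
  toFun s := ∑ β ∈ (Finset.univ : Finset (Fin n)).finsuppAntidiag j.toNat,
    -- The test matters for `j < 0`: there `toNat` is 0 and `β = 0` must be excluded.
    if (β.degree : ℤ) = j then MvPolynomial.monomial β (MvPowerSeries.coeff β s) else 0
  map_zero' := by simp
  map_add' s t := by
    rw [← Finset.sum_add_distrib]
    refine Finset.sum_congr rfl fun β _ => ?_
    split_ifs <;> simp

theorem coeff_homPart (j : ℤ) (s : PSer n k) (β : Fin n →₀ ℕ) :
    MvPolynomial.coeff β (homPart j s) =
      if (β.degree : ℤ) = j then MvPowerSeries.coeff β s else 0 := by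
  classical
  change MvPolynomial.coeff β (∑ γ ∈ _, _) = _
  rw [MvPolynomial.coeff_sum, Finset.sum_eq_single β]
  · split_ifs <;> simp
  · intro γ _ hγ
    split_ifs <;> simp [MvPolynomial.coeff_monomial, hγ]
  · intro hβ
    rw [if_neg, MvPolynomial.coeff_zero]
    intro h
    refine hβ (Finset.mem_finsuppAntidiag'.mpr ⟨?_, Finset.subset_univ _⟩)
    rw [← h, Int.toNat_natCast, Finsupp.degree_apply]
    rfl

theorem eq_of_homPart_eq {s t : PSer n k} (h : ∀ j, homPart j s = homPart j t) : s = t := by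
  ext β
  have := congrArg (MvPolynomial.coeff β) (h β.degree)
  simpa [coeff_homPart] using this

theorem homPart_C_smul (j : ℤ) (a : k) (s : PSer n k) :
    homPart j ((MvPolynomial.C a : Poly n k) • s) = MvPolynomial.C a * homPart j s := by
  ext β
  rw [poly_smul_eq, MvPolynomial.coe_C]
  simp [coeff_homPart]

theorem homPart_X_smul (j : ℤ) (i : Fin n) (s : PSer n k) :
    homPart j ((MvPolynomial.X i : Poly n k) • s) = MvPolynomial.X i * homPart (j - 1) s := by
  classical
  ext β
  rw [poly_smul_eq, MvPolynomial.coe_X,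
    coeff_homPart, MvPolynomial.coeff_X_mul', MvPowerSeries.X, MvPowerSeries.coeff_monomial_mul]
  by_cases hs : i ∈ β.support
  · have hle : Finsupp.single i 1 ≤ β := by
      rw [Finsupp.single_le_iff]
      have := Finsupp.mem_support_iff.mp hs
      omega
    obtain ⟨γ, rfl⟩ := exists_add_of_le hle
    have h : ((1 : ℤ) + (γ.degree : ℤ) = j) ↔ ((γ.degree : ℤ) = j - 1) := by omega
    rw [if_pos hs, if_pos hle]
    simp [coeff_homPart, h]
  · have hle : ¬ Finsupp.single i 1 ≤ β := by
      rw [Finsupp.single_le_iff]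
      have := Finsupp.notMem_support_iff.mp hs
      omega
    simp [hs, hle]

theorem homPart_pderiv (j : ℤ) (i : Fin n) (s : PSer n k) :
    homPart j (MvPowerSeries.pderiv k i s) = MvPolynomial.pderiv i (homPart (j + 1) s) := by
  ext β
  rw [coeff_homPart, MvPolynomial.coeff_pderiv, coeff_homPart, MvPowerSeries.coeff_pderiv]
  have h : (((β + Finsupp.single i 1).degree : ℕ) : ℤ) = j + 1 ↔ (β.degree : ℤ) = j := by
    simp
  simp only [h]
  split_ifs <;> simp

theorem homPart_one (j : ℤ) : homPart j (1 : PSer n k) = if j = 0 then 1 else 0 := by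
  classical
  ext β
  rw [coeff_homPart, MvPowerSeries.coeff_one]
  rcases eq_or_ne β 0 with rfl | hβ
  · by_cases hj : j = 0
    · simp [hj]
    · simp [hj, Ne.symm hj]
  · by_cases hj : j = 0
    · simp [hj, hβ, MvPolynomial.coeff_one, hβ.symm]
    · simp [hj, hβ]

theorem homPart_coe_homPart (j j' : ℤ) (s : PSer n k) :
    homPart j (homPart j' s : PSer n k) = if j = j' then homPart j' s else 0 := by
  ext β
  rw [coeff_homPart, MvPolynomial.coeff_coe, coeff_homPart]
  by_cases h : j = j'
  · subst h
    simp only [if_true, coeff_homPart]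
    split_ifs <;> rfl
  · rw [if_neg h, MvPolynomial.coeff_zero]
    split_ifs <;> first | rfl | omega

theorem exists_sum_homPart (f : Poly n k) :
    ∃ F : Finset ℤ, ∑ j ∈ F, homPart j (f : PSer n k) = f := by
  classical
  refine ⟨f.support.image fun β => (β.degree : ℤ), ?_⟩
  ext β
  simp only [MvPolynomial.coeff_sum, coeff_homPart, MvPolynomial.coeff_coe, Finset.sum_ite_eq]
  split_ifs with h
  · rfl
  · refine (MvPolynomial.notMem_support_iff.mp fun hβ => h ?_).symm
    exact Finset.mem_image_of_mem _ hβ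

end HomogeneousParts

/-! ### Graded modules and homogeneous components in the completion -/

section Grading

variable (n : ℕ) (k : Type*) [Field k]

/-- A `ℤ`-grading of a module over `k[x₁, …, xₙ]`, given by its projections. -/
structure GrProj (X : Type*) [AddCommGroup X] [Module (Poly n k) X] where
  proj : ℤ → X →+ X
  proj_C : ∀ l (a : k) x, proj l ((MvPolynomial.C a : Poly n k) • x) =
    (MvPolynomial.C a : Poly n k) • proj l x
  proj_X : ∀ l i x, proj l ((MvPolynomial.X i : Poly n k) • x) =
    (MvPolynomial.X i : Poly n k) • proj (l - 1) x
  proj_proj : ∀ l l' x, proj l (proj l' x) = if l = l' then proj l' x else 0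
  exists_sum : ∀ x, ∃ F : Finset ℤ, ∑ l ∈ F, proj l x = x

variable {n k}
variable {X : Type*} [AddCommGroup X] [Module (Poly n k) X] (G : GrProj n k X)

namespace GrProj

theorem proj_eq_zero {F : Finset ℤ} {x : X} (h : ∑ l ∈ F, G.proj l x = x) {l : ℤ} (hl : l ∉ F) :
    G.proj l x = 0 := by
  rw [← h, map_sum]
  refine Finset.sum_eq_zero fun l' hl' => ?_
  rw [G.proj_proj, if_neg]
  rintro rfl
  exact hl hl'

theorem sum_of_subset {F F' : Finset ℤ} {x : X} (h : ∑ l ∈ F, G.proj l x = x) (hF : F ⊆ F') :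
    ∑ l ∈ F', G.proj l x = x := by
  rw [← Finset.sum_subset hF fun l _ hl => G.proj_eq_zero h hl, h]

theorem finite_support (x : X) : {l | G.proj l x ≠ 0}.Finite := by
  obtain ⟨F, hF⟩ := G.exists_sum x
  refine F.finite_toSet.subset fun l hl => ?_
  by_contra h
  exact hl (G.proj_eq_zero hF h)

/-- Equivariance under constants and variables suffices, by induction on `f`; the integer index of
`homPart` avoids separating the case `l < e`. -/
theorem proj_smul {e : ℤ} {x : X} (hx : G.proj e x = x) (f : Poly n k) (l : ℤ) :
    G.proj l (f • x) = homPart (l - e) (f : PSer n k) • x := by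
  induction f using MvPolynomial.induction_on generalizing l with
  | C a =>
    rw [G.proj_C]
    have h := homPart_C_smul (l - e) a (1 : PSer n k)
    rw [poly_smul_eq, mul_one] at h
    rw [h, homPart_one]
    have h2 := G.proj_proj l e x
    rw [hx] at h2
    rw [h2]
    by_cases hle : l = e
    · simp [hle]
    · simp [hle, sub_eq_zero]
  | add p q hp hq => rw [add_smul, map_add, hp, hq, MvPolynomial.coe_add, map_add, add_smul]
  | mul_X p i hp =>
    rw [mul_comm, mul_smul, G.proj_X, hp, ← mul_smul, show l - 1 - e = l - e - 1 by ring,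
      ← homPart_X_smul, poly_smul_eq, MvPolynomial.coe_mul]

theorem proj_smul_mem {N : Submodule (Poly n k) X} {x : X} (hx : ∀ l, G.proj l x ∈ N)
    (f : Poly n k) (l : ℤ) : G.proj l (f • x) ∈ N := by
  induction f using MvPolynomial.induction_on generalizing l with
  | C a => rw [G.proj_C]; exact N.smul_mem _ (hx l)
  | add p q hp hq => rw [add_smul, map_add]; exact N.add_mem (hp l) (hq l)
  | mul_X p i hp => rw [mul_comm, mul_smul, G.proj_X]; exact N.smul_mem _ (hp _)

/-- A submodule generated by elements whose homogeneous components lie in it is homogeneous. -/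
theorem proj_mem_of_span {A : Set X} {N : Submodule (Poly n k) X}
    (hA : ∀ x ∈ A, ∀ l, G.proj l x ∈ N) {x : X} (hx : x ∈ Submodule.span (Poly n k) A) (l : ℤ) :
    G.proj l x ∈ N := by
  induction hx using Submodule.span_induction generalizing l with
  | mem x hx => exact hA x hx l
  | zero => simp
  | add x y _ _ hx hy => rw [map_add]; exact N.add_mem (hx l) (hy l)
  | smul f x _ hx => exact G.proj_smul_mem hx f l

/-- A finitely generated homogeneous submodule has finitely many homogeneous generators. -/
theorem exists_homogeneous_generators {N : Submodule (Poly n k) X} (hfg : N.FG)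
    (hN : ∀ x ∈ N, ∀ l, G.proj l x ∈ N) :
    ∃ (t : ℕ) (g : Fin t → X) (d : Fin t → ℤ), (∀ a, G.proj (d a) (g a) = g a) ∧
      Submodule.span (Poly n k) (Set.range g) = N := by
  obtain ⟨A, hA⟩ := hfg
  choose F hF using G.exists_sum
  let e := Fintype.equivFin (Σ x : A, F x.1)
  let v (z : Σ x : A, F x.1) : X := G.proj z.2.1 z.1.1
  refine ⟨_, fun a => v (e.symm a), fun a => (e.symm a).2.1,
    fun a => by simp only [v, G.proj_proj, if_true], le_antisymm ?_ ?_⟩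
  · refine Submodule.span_le.mpr ?_
    rintro _ ⟨a, rfl⟩
    exact hN _ (hA ▸ Submodule.subset_span (e.symm a).1.2) _
  · rw [← hA]
    refine Submodule.span_le.mpr fun x hx => ?_
    rw [SetLike.mem_coe, ← hF x]
    refine Submodule.sum_mem _ fun l hl => Submodule.subset_span ⟨e ⟨⟨x, hx⟩, ⟨l, hl⟩⟩, ?_⟩
    simp only [Equiv.symm_apply_apply, v]

/-- Homogeneous elements of a module generated by homogeneous elements `g a`, one in each degree,
are the components of a combination of the `g a` with power series coefficients. -/
theorem exists_series {ι : Type*} [Fintype ι] (g : ι → X) (d : ι → ℤ)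
    (hg : ∀ a, G.proj (d a) (g a) = g a) (y : ℤ → X)
    (hy : ∀ l, y l ∈ Submodule.span (Poly n k) (Set.range g)) (hy' : ∀ l, G.proj l (y l) = y l) :
    ∃ s : ι → PSer n k, ∀ l, ∑ a, homPart (l - d a) (s a) • g a = y l := by
  choose c hc using fun l => (Submodule.mem_span_range_iff_exists_fun (Poly n k)).mp (hy l)
  -- Only the part of `c l a` of degree `l - d a` contributes in degree `l`, so the coefficient at
  -- `β` is taken from the one `l` with `|β| = l - d a`.
  let s (a : ι) : PSer n k := fun β => MvPolynomial.coeff β (c (β.degree + d a) a)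
  have hs : ∀ a β, MvPowerSeries.coeff β (s a) = MvPolynomial.coeff β (c (β.degree + d a) a) :=
    fun _ _ => rfl
  refine ⟨s, fun l => ?_⟩
  rw [← hy' l, ← hc l, map_sum]
  refine Finset.sum_congr rfl fun a _ => ?_
  rw [G.proj_smul (hg a)]
  congr 1
  ext β
  rw [coeff_homPart, coeff_homPart]
  split_ifs with h
  · rw [MvPolynomial.coeff_coe, hs, h, sub_add_cancel]
  · rfl

/-- The standard grading of the polynomial ring, shifted by `d`. -/
def poly (d : ℤ) : GrProj n k (Poly n k) where
  proj l := (homPart (l - d)).comp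
    (MvPolynomial.coeToMvPowerSeries.ringHom : Poly n k →+* PSer n k).toAddMonoidHom
  proj_C l a x := by
    change homPart (l - d) ((MvPolynomial.C a * x : Poly n k) : PSer n k) = _
    have := homPart_C_smul (l - d) a (x : PSer n k)
    rwa [poly_smul_eq, ← MvPolynomial.coe_mul] at this
  proj_X l i x := by
    change homPart (l - d) ((MvPolynomial.X i * x : Poly n k) : PSer n k) =
      MvPolynomial.X i * homPart (l - 1 - d) (x : PSer n k)
    have := homPart_X_smul (l - d) i (x : PSer n k)
    rwa [poly_smul_eq,
      ← MvPolynomial.coe_mul, show l - d - 1 = l - 1 - d by ring] at this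
  proj_proj l l' x := by
    refine (homPart_coe_homPart (l - d) (l' - d) (x : PSer n k)).trans ?_
    simp only [sub_left_inj]
    rfl
  exists_sum x := by
    obtain ⟨F, hF⟩ := exists_sum_homPart x
    refine ⟨F.map (Equiv.addRight d).toEmbedding, ?_⟩
    rw [Finset.sum_map]
    simpa using hF

theorem poly_proj (d l : ℤ) (f : Poly n k) :
    (poly d).proj l f = homPart (l - d) (f : PSer n k) := rfl

/-- The product grading. -/
def pi {ι : Type*} [Fintype ι] {Y : ι → Type*} [∀ a, AddCommGroup (Y a)]
    [∀ a, Module (Poly n k) (Y a)] (H : ∀ a, GrProj n k (Y a)) : GrProj n k (∀ a, Y a) where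
  proj l := AddMonoidHom.mk' (fun v a => (H a).proj l (v a)) fun v w => by
    funext a
    simp
  proj_C l a x := funext fun b => (H b).proj_C l a (x b)
  proj_X l i x := funext fun b => (H b).proj_X l i (x b)
  proj_proj l l' x := by
    funext b
    change (H b).proj l ((H b).proj l' (x b)) = _
    rw [(H b).proj_proj]
    split_ifs <;> rfl
  exists_sum x := by
    classical
    choose F hF using fun a => (H a).exists_sum (x a)
    refine ⟨Finset.univ.biUnion F, funext fun a => ?_⟩
    rw [Finset.sum_apply]
    exact (H a).sum_of_subset (hF a) (Finset.subset_biUnion_of_mem F (Finset.mem_univ a))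

/-! ### Homogeneous components of elements of the completion -/

theorem finite_support_smul (l : ℤ) (s : PSer n k) (x : X) :
    (Function.support fun e => homPart (l - e) s • G.proj e x).Finite :=
  (G.finite_support x).subset fun e he h => he (by simp [h])

/-- The component of degree `l` of `s ⊗ x`. -/
def tensorCompAux (l : ℤ) : PSer n k →+ X →+ X :=
  AddMonoidHom.mk' (fun s => AddMonoidHom.mk' (fun x => ∑ᶠ e, homPart (l - e) s • G.proj e x)
    fun x y => by
      rw [← finsum_add_distrib (G.finite_support_smul l s x) (G.finite_support_smul l s y)]
      simp) fun s t => by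
    ext x
    change ∑ᶠ e, homPart (l - e) (s + t) • G.proj e x =
      ∑ᶠ e, homPart (l - e) s • G.proj e x + ∑ᶠ e, homPart (l - e) t • G.proj e x
    rw [← finsum_add_distrib (G.finite_support_smul l s x) (G.finite_support_smul l t x)]
    simp [add_smul]

theorem tensorCompAux_apply (l : ℤ) (s : PSer n k) (x : X) :
    G.tensorCompAux l s x = ∑ᶠ e, homPart (l - e) s • G.proj e x := rfl

/-- Balancedness, needed to descend to the tensor product over `R`. For a variable it is the
reindexing `e ↦ e + 1`. -/
theorem tensorCompAux_smul (l : ℤ) (f : Poly n k) (s : PSer n k) (x : X) :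
    G.tensorCompAux l (f • s) x = G.tensorCompAux l s (f • x) := by
  induction f using MvPolynomial.induction_on generalizing s x with
  | C a =>
    simp only [tensorCompAux_apply, homPart_C_smul, G.proj_C, mul_comm (MvPolynomial.C a), mul_smul]
  | add p q hp hq => simp only [add_smul, map_add, AddMonoidHom.add_apply, hp, hq]
  | mul_X p i hp =>
    have hX : G.tensorCompAux l ((MvPolynomial.X i : Poly n k) • s) (p • x) =
        G.tensorCompAux l s ((MvPolynomial.X i : Poly n k) • p • x) := by
      simp only [tensorCompAux_apply]
      rw [← finsum_comp_equiv (Equiv.addRight (1 : ℤ))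
        (f := fun e => homPart (l - e) s • G.proj e ((MvPolynomial.X i : Poly n k) • p • x))]
      refine finsum_congr fun e => ?_
      simp only [homPart_X_smul, Equiv.coe_addRight, G.proj_X, add_sub_cancel_right]
      rw [mul_comm, mul_smul, sub_sub]
    rw [mul_smul, hp, hX, smul_smul, mul_comm]

/-- The component of degree `l` of an element of `R̂ ⊗ X`. -/
def tensorComp (l : ℤ) : PSer n k ⊗[Poly n k] X →+ X :=
  TensorProduct.liftAddHom (G.tensorCompAux l) fun f s x => G.tensorCompAux_smul l f s x

theorem tensorComp_tmul (l : ℤ) (s : PSer n k) (x : X) :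
    G.tensorComp l (s ⊗ₜ x) = ∑ᶠ e, homPart (l - e) s • G.proj e x := rfl

theorem tensorComp_tmul_of_homogeneous (l : ℤ) (s : PSer n k) {e : ℤ} {x : X}
    (hx : G.proj e x = x) : G.tensorComp l (s ⊗ₜ x) = homPart (l - e) s • x := by
  rw [tensorComp_tmul, finsum_eq_single _ e, hx]
  intro e' he'
  rw [← hx, G.proj_proj, if_neg he', smul_zero]

theorem tensorComp_one_tmul (l : ℤ) (x : X) : G.tensorComp l (1 ⊗ₜ x) = G.proj l x := by
  rw [tensorComp_tmul, finsum_eq_single _ l]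
  · simp [homPart_one]
  · intro e he
    rw [homPart_one, if_neg (by omega), zero_smul]

theorem proj_tensorComp (l : ℤ) (x : PSer n k ⊗[Poly n k] X) :
    G.proj l (G.tensorComp l x) = G.tensorComp l x := by
  induction x using TensorProduct.induction_on with
  | zero => simp
  | add x y hx hy => simp only [map_add, hx, hy]
  | tmul s x =>
    obtain ⟨F, hF⟩ := G.exists_sum x
    rw [← hF, TensorProduct.tmul_sum, map_sum, map_sum]
    refine Finset.sum_congr rfl fun e _ => ?_
    have hx : G.proj e (G.proj e x) = G.proj e x := by rw [G.proj_proj, if_pos rfl]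
    rw [G.tensorComp_tmul_of_homogeneous l s hx, G.proj_smul hx, homPart_coe_homPart, if_pos rfl]

theorem tensorComp_tmul_mem {N : Submodule (Poly n k) X} {x : X} (hx : ∀ e, G.proj e x ∈ N) (l : ℤ)
    (s : PSer n k) : G.tensorComp l (s ⊗ₜ x) ∈ N := by
  rw [tensorComp_tmul]
  exact finsum_induction (· ∈ N) N.zero_mem (fun _ _ => N.add_mem) fun e => N.smul_mem _ (hx e)

theorem span_homogeneous (x : PSer n k ⊗[Poly n k] X) :
    x ∈ Submodule.span (PSer n k) {z | ∃ e m, G.proj e m = m ∧ 1 ⊗ₜ m = z} := by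
  induction x using TensorProduct.induction_on with
  | zero => exact Submodule.zero_mem _
  | add x y hx hy => exact Submodule.add_mem _ hx hy
  | tmul s x =>
    obtain ⟨F, hF⟩ := G.exists_sum x
    rw [← hF, TensorProduct.tmul_sum]
    refine Submodule.sum_mem _ fun e _ => ?_
    have h : s ⊗ₜ[Poly n k] G.proj e x = s • (1 ⊗ₜ G.proj e x) := by
      rw [TensorProduct.smul_tmul', smul_eq_mul, mul_one]
    rw [h]
    exact Submodule.smul_mem _ _ (Submodule.subset_span
      ⟨e, _, by rw [G.proj_proj, if_pos rfl], rfl⟩)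

/-- In `R̂ ⊗ R` the tensors `(f • s) ⊗ 1` and `s ⊗ f` agree; the two sides are their components of
degree `j`. -/
theorem homPart_smul_of_homogeneous {f : Poly n k} {c : ℤ} (hf : homPart c (f : PSer n k) = f)
    (j : ℤ) (s : PSer n k) : homPart j (f • s) = homPart (j - c) s * f := by
  have h1 := (poly 0).tensorComp_tmul_of_homogeneous j (f • s) (e := 0) (x := (1 : Poly n k))
    (by rw [poly_proj, MvPolynomial.coe_one, homPart_one]; simp)
  rw [TensorProduct.smul_tmul, smul_eq_mul, mul_one,
    (poly 0).tensorComp_tmul_of_homogeneous j s (e := c) (x := f)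
      (by rw [poly_proj, sub_zero, hf])] at h1
  simpa using h1.symm

/-- An element of `R̂ ⊗ X` is determined by its homogeneous components. -/
theorem tensorComp_injective {x : PSer n k ⊗[Poly n k] X} (hx : ∀ l, G.tensorComp l x = 0) :
    x = 0 := by
  obtain ⟨t, s, z, rfl⟩ := Submodule.mem_span_set'.mp (G.span_homogeneous x)
  choose d g hg hz using fun a => (z a).2
  have hx' : ∑ a, s a • (z a : PSer n k ⊗[Poly n k] X) = ∑ a, s a ⊗ₜ g a :=
    Finset.sum_congr rfl fun a _ => by
      rw [← hz, TensorProduct.smul_tmul', smul_eq_mul, mul_one]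
  rw [hx'] at hx ⊢
  -- The free module with its `a`-th basis vector in degree `d a`, so that `φ` preserves degrees and
  -- its kernel is homogeneous.
  let H : GrProj n k (Fin t → Poly n k) := pi fun a => poly (d a)
  let φ := Fintype.linearCombination (Poly n k) g
  have hφ : ∀ v, φ v = ∑ a, v a • g a := fun v => Fintype.linearCombination_apply _ _ _
  have hK : ∀ v ∈ LinearMap.ker φ, ∀ l, H.proj l v ∈ LinearMap.ker φ := by
    intro v hv l
    rw [LinearMap.mem_ker, hφ] at hv ⊢
    rw [← map_zero (G.proj l), ← hv, map_sum]
    refine Finset.sum_congr rfl fun a _ => ?_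
    rw [G.proj_smul (hg a)]
    rfl
  obtain ⟨u, ρ, e, hρ, hspan⟩ := H.exists_homogeneous_generators (IsNoetherian.noetherian _) hK
  -- The vanishing of components says that the homogeneous parts of `s` are relations among the `g
  -- a`. Hence `s` is a power series combination of the relations `ρ b`, which can be moved across
  -- the tensor sign: a graded form of flatness.
  obtain ⟨F, hF⟩ := H.exists_series ρ e hρ (fun l a => homPart (l - d a) (s a))
    (fun l => by
      rw [hspan, LinearMap.mem_ker, hφ, ← hx l, map_sum]
      exact Finset.sum_congr rfl fun a _ => (G.tensorComp_tmul_of_homogeneous l _ (hg a)).symm)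
    (fun l => by
      funext a
      change homPart (l - d a) (homPart (l - d a) (s a) : PSer n k) = _
      rw [homPart_coe_homPart, if_pos rfl])
  have hs : ∀ a, s a = ∑ b, ρ b a • F b := by
    intro a
    refine eq_of_homPart_eq fun j => ?_
    have h := congrFun (hF (j + d a)) a
    simp only [add_sub_cancel_right, Finset.sum_apply, Pi.smul_apply, smul_eq_mul] at h
    rw [← h, map_sum]
    refine Finset.sum_congr rfl fun b _ => ?_
    have hρ' : homPart (e b - d a) (ρ b a : PSer n k) = ρ b a := congrFun (hρ b) a
    rw [homPart_smul_of_homogeneous hρ']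
    rw [show j + d a - e b = j - (e b - d a) by ring]
  have hker : ∀ b, ∑ a, ρ b a • g a = 0 := fun b => by
    rw [← hφ]
    exact LinearMap.mem_ker.mp (hspan ▸ Submodule.subset_span ⟨b, rfl⟩)
  calc ∑ a, s a ⊗ₜ[Poly n k] g a = ∑ a, ∑ b, F b ⊗ₜ[Poly n k] (ρ b a • g a) := by
        refine Finset.sum_congr rfl fun a _ => ?_
        rw [hs a, TensorProduct.sum_tmul]
        exact Finset.sum_congr rfl fun b _ => TensorProduct.smul_tmul _ _ _
    _ = ∑ b, F b ⊗ₜ[Poly n k] ∑ a, ρ b a • g a := by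
        rw [Finset.sum_comm]
        simp_rw [TensorProduct.tmul_sum]
    _ = 0 := by simp [hker]

/-- Homogeneous elements of a finitely generated homogeneous submodule, one in each degree, are
the components of an element of `R̂ ⊗ X`. -/
theorem exists_tensorComp_eq {N : Submodule (Poly n k) X} (hfg : N.FG)
    (hN : ∀ x ∈ N, ∀ l, G.proj l x ∈ N) (y : ℤ → X) (hy : ∀ l, y l ∈ N)
    (hy' : ∀ l, G.proj l (y l) = y l) :
    ∃ x : PSer n k ⊗[Poly n k] X, ∀ l, G.tensorComp l x = y l := by
  obtain ⟨t, g, d, hg, hspan⟩ := G.exists_homogeneous_generators hfg hN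
  obtain ⟨s, hs⟩ := G.exists_series g d hg y (fun l => hspan ▸ hy l) hy'
  refine ⟨∑ a, s a ⊗ₜ g a, fun l => ?_⟩
  rw [map_sum, ← hs l]
  exact Finset.sum_congr rfl fun a _ => G.tensorComp_tmul_of_homogeneous l _ (hg a)

end GrProj

end Grading

/-! ### Taylor expansion of operators by iterated commutators -/

section WeylTaylor

variable {k B : Type*} [Field k] [Ring B] [Algebra k B]

/-- The commutator `[·, x]`. -/
def adRight (x P : B) : B := P * x - x * P

theorem adRight_comm {x y : B} (h : x * y = y * x) (P : B) :
    adRight x (adRight y P) = adRight y (adRight x P) := by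
  simp only [adRight, sub_mul, mul_sub, mul_assoc, h]
  simp only [← mul_assoc, h]
  abel

theorem adRight_iterate_eq_zero {x y : B} (h : x * y = y * x) {P : B} (hP : adRight y P = 0)
    (m : ℕ) : adRight y ((adRight x)^[m] P) = 0 := by
  induction m with
  | zero => exact hP
  | succ m ih => rw [Function.iterate_succ_apply', adRight_comm h.symm, ih]; simp [adRight]

variable (k) in
/-- The partial sums of `∑ₘ (-1)^m / m! [P, x]^(m) ∂^m`, where `[P, x]^(m)` is an iterated
commutator. -/
def taylorSum (x d P : B) (m : ℕ) : B :=
  ∑ j ∈ Finset.range (m + 1), ((-1) ^ j / (j.factorial : k)) • ((adRight x)^[j] P * d ^ j)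

theorem pow_succ_mul_of_commutator {x d : B} (h : d * x = x * d + 1) (m : ℕ) :
    d ^ (m + 1) * x = x * d ^ (m + 1) + (m + 1 : ℕ) • d ^ m := by
  induction m with
  | zero => simpa using h
  | succ m ih =>
    rw [pow_succ' d (m + 1), mul_assoc, ih, mul_add, ← mul_assoc, h, add_mul, one_mul, mul_assoc,
      mul_smul_comm, ← pow_succ', ← pow_succ', add_assoc, succ_nsmul _ (m + 1), add_comm (d ^ _)]

/-- Since `[Q d^(m+1), x] = [Q, x] d^(m+1) + (m+1) Q d^m`, the commutators of consecutive terms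
telescope. The surviving one vanishes when `x` is a multiplication and `P` has order at most `m`. -/
theorem adRight_taylorSum [CharZero k] {x d : B} (h : d * x = x * d + 1) (P : B) (m : ℕ) :
    adRight x (taylorSum k x d P m) =
      ((-1) ^ m / (m.factorial : k)) • ((adRight x)^[m + 1] P * d ^ m) := by
  induction m with
  | zero => simp [taylorSum]
  | succ m ih =>
    have hadd : ∀ P Q : B, adRight x (P + Q) = adRight x P + adRight x Q := fun P Q => by
      simp only [adRight, add_mul, mul_add]; abel
    have hsmul : ∀ (c : k) (P : B), adRight x (c • P) = c • adRight x P := fun c P => by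
      simp only [adRight, smul_mul_assoc, mul_smul_comm, smul_sub]
    have hmul : ∀ Q : B, adRight x (Q * d ^ (m + 1)) =
        adRight x Q * d ^ (m + 1) + (m + 1 : k) • (Q * d ^ m) := fun Q => by
      simp only [adRight, sub_mul]
      rw [mul_assoc Q, pow_succ_mul_of_commutator h, mul_add, mul_assoc, mul_assoc,
        ← Nat.cast_smul_eq_nsmul k, mul_smul_comm]
      push_cast
      abel
    rw [taylorSum, Finset.sum_range_succ, ← taylorSum, hadd, ih, hsmul, hmul, smul_add, smul_smul,
      ← Function.iterate_succ_apply' (adRight x), add_comm (_ • (_ * d ^ (m + 1))), ← add_assoc,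
      ← add_smul]
    have hc : (-1 : k) ^ m / (m.factorial : k) +
        (-1) ^ (m + 1) / ((m + 1).factorial : k) * (m + 1) = 0 := by
      have h1 : (m.factorial : k) ≠ 0 := Nat.cast_ne_zero.mpr m.factorial_ne_zero
      have h2 : (m + 1 : k) ≠ 0 := Nat.cast_add_one_ne_zero m
      rw [Nat.factorial_succ]
      push_cast
      field_simp
      ring
    rw [hc, zero_smul, zero_add]

/-- Correcting for one variable keeps commutation with those already treated. -/
theorem adRight_taylorSum_eq_zero {x d y P : B} (hxy : x * y = y * x) (hd : d * y = y * d)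
    (hP : adRight y P = 0) (m : ℕ) : adRight y (taylorSum k x d P m) = 0 := by
  rw [adRight, taylorSum, Finset.sum_mul, Finset.mul_sum, ← Finset.sum_sub_distrib]
  refine Finset.sum_eq_zero fun j _ => ?_
  have h := adRight_iterate_eq_zero hxy hP j
  rw [adRight, sub_eq_zero] at h
  have hd' : d ^ j * y = y * d ^ j := (Commute.pow_left (hd : Commute d y) j)
  rw [smul_mul_assoc, mul_smul_comm, mul_assoc, hd', ← mul_assoc, h, mul_assoc, sub_self]

end WeylTaylor

/-! ### Orders of sums, powers and iterated commutators -/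

section Generation

variable {k A : Type*} [CommRing k] [CommRing A] [Algebra k A]

theorem HasOrderLE.smul {p : ℕ} {P : Module.End k A} (hP : HasOrderLE k A p P) (c : k) :
    HasOrderLE k A p (c • P) := by
  have h : c • P = Algebra.lmul k A (algebraMap k A c) * P := by
    ext a
    simp [Algebra.smul_def]
  rw [h, ← Nat.zero_add p]
  exact (HasOrderLE.lmul _).mul hP

theorem derivation_mul_lmul (δ : Derivation k A A) (a : A) :
    (δ : A →ₗ[k] A) * Algebra.lmul k A a =
      Algebra.lmul k A a * (δ : A →ₗ[k] A) + Algebra.lmul k A (δ a) :=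
  congrArg Subtype.val (derivOp_mul_mulOp δ a)

theorem HasOrderLE.sum {p : ℕ} {ι : Type*} (s : Finset ι) (P : ι → Module.End k A)
    (hP : ∀ i ∈ s, HasOrderLE k A p (P i)) : HasOrderLE k A p (∑ i ∈ s, P i) :=
  Finset.sum_induction _ (HasOrderLE k A p) (fun _ _ => HasOrderLE.add) (HasOrderLE.zero p) hP

theorem HasOrderLE.pow {p : ℕ} {P : Module.End k A} (hP : HasOrderLE k A p P) (m : ℕ) :
    HasOrderLE k A (m * p) (P ^ m) := by
  induction m with
  | zero =>
    rw [pow_zero, Nat.zero_mul, ← map_one (Algebra.lmul k A)]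
    exact HasOrderLE.lmul 1
  | succ m ih => rw [pow_succ, Nat.succ_mul]; exact ih.mul hP

theorem HasOrderLE.adRight_iterate {p : ℕ} {P : Module.End k A} (hP : HasOrderLE k A p P) (a : A)
    {m : ℕ} (hm : m ≤ p) : HasOrderLE k A (p - m) ((adRight (Algebra.lmul k A a))^[m] P) := by
  induction m generalizing p P with
  | zero => exact hP
  | succ m ih =>
    obtain ⟨p, rfl⟩ : ∃ q, p = q + 1 := ⟨p - 1, by omega⟩
    rw [Function.iterate_succ_apply]
    have := ih (hP a) (by omega : m ≤ p)
    rwa [Nat.add_sub_add_right]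

theorem HasOrderLE.adRight_iterate_succ {p : ℕ} {P : Module.End k A} (hP : HasOrderLE k A p P)
    (a : A) : (adRight (Algebra.lmul k A a))^[p + 1] P = 0 := by
  rw [Function.iterate_succ_apply']
  have := hP.adRight_iterate a le_rfl
  rw [Nat.sub_self] at this
  exact this a

end Generation

/-! ### Generation of `𝒟` by multiplications and partial derivatives -/

section Weyl

variable {n : ℕ} {k : Type*} [Field k]

variable (n k) in
/-- The generators `f` and `∂ᵢ` of the ring of differential operators on the polynomial ring. -/
def weylGenerators : Set (Module.End k (Poly n k)) :=
  Set.range (Algebra.lmul k (Poly n k)) ∪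
    Set.range fun i : Fin n => (MvPolynomial.pderiv (R := k) i : Poly n k →ₗ[k] Poly n k)

/-- Commuting with the variables forces `R`-linearity, so `P` is multiplication by `P 1`. -/
theorem mem_adjoin_of_commute_X {P : Module.End k (Poly n k)}
    (hP : ∀ i, adRight (Algebra.lmul k (Poly n k) (MvPolynomial.X i)) P = 0) :
    P ∈ Algebra.adjoin k (weylGenerators n k) := by
  have h : P = Algebra.lmul k (Poly n k) (P 1) := by
    refine LinearMap.ext fun f => ?_
    change P f = P 1 * f
    induction f using MvPolynomial.induction_on with
    | C a =>
      rw [← MvPolynomial.algebraMap_eq, Algebra.algebraMap_eq_smul_one, map_smul, mul_smul_comm,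
        mul_one]
    | add p q hp hq => rw [map_add, hp, hq, mul_add]
    | mul_X p i hp =>
      have h := LinearMap.congr_fun (hP i) p
      have h' : P (MvPolynomial.X i * p) - MvPolynomial.X i * P p = 0 := h
      rw [sub_eq_zero] at h'
      rw [mul_comm p, h', hp]
      ring
  rw [h]
  exact Algebra.subset_adjoin (Or.inl ⟨_, rfl⟩)

theorem lmul_mul_comm (f g : Poly n k) :
    Algebra.lmul k (Poly n k) f * Algebra.lmul k (Poly n k) g =
      Algebra.lmul k (Poly n k) g * Algebra.lmul k (Poly n k) f :=
  sub_eq_zero.mp (HasOrderLE.lmul f g)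

theorem pderiv_mul_lmul_X_self (i : Fin n) :
    (MvPolynomial.pderiv (R := k) i : Poly n k →ₗ[k] Poly n k) *
        Algebra.lmul k (Poly n k) (MvPolynomial.X i) =
      Algebra.lmul k (Poly n k) (MvPolynomial.X i) *
        (MvPolynomial.pderiv (R := k) i : Poly n k →ₗ[k] Poly n k) + 1 := by
  rw [derivation_mul_lmul, MvPolynomial.pderiv_X_self, map_one]

theorem pderiv_mul_lmul_X_of_ne {i j : Fin n} (h : j ≠ i) :
    (MvPolynomial.pderiv (R := k) i : Poly n k →ₗ[k] Poly n k) *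
        Algebra.lmul k (Poly n k) (MvPolynomial.X j) =
      Algebra.lmul k (Poly n k) (MvPolynomial.X j) *
        (MvPolynomial.pderiv (R := k) i : Poly n k →ₗ[k] Poly n k) := by
  rw [derivation_mul_lmul, MvPolynomial.pderiv_X_of_ne h, map_zero, add_zero]

/-- In characteristic zero the ring of differential operators on a polynomial ring is generated
by multiplications and partial derivatives. -/
theorem HasOrderLE.mem_adjoin [CharZero k] {p : ℕ} {P : Module.End k (Poly n k)}
    (hP : HasOrderLE k (Poly n k) p P) : P ∈ Algebra.adjoin k (weylGenerators n k) := by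
  induction p generalizing P with
  | zero => exact mem_adjoin_of_commute_X fun i => hP _
  | succ p ih =>
    let x (i : Fin n) : Module.End k (Poly n k) := Algebra.lmul k (Poly n k) (MvPolynomial.X i)
    let d (i : Fin n) : Module.End k (Poly n k) :=
      (MvPolynomial.pderiv (R := k) i : Poly n k →ₗ[k] Poly n k)
    have hx : ∀ i j, x i * x j = x j * x i := fun i j => lmul_mul_comm _ _
    have hdx : ∀ i, d i * x i = x i * d i + 1 := pderiv_mul_lmul_X_self
    have hdx' : ∀ i j, j ≠ i → d i * x j = x j * d i := fun i j => pderiv_mul_lmul_X_of_ne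
    have key : ∀ s : Finset (Fin n), ∃ P' : Module.End k (Poly n k),
        HasOrderLE k (Poly n k) (p + 1) P' ∧ P - P' ∈ Algebra.adjoin k (weylGenerators n k) ∧
        ∀ i ∈ s, adRight (x i) P' = 0 := by
      intro s
      induction s using Finset.induction_on with
      | empty => exact ⟨P, hP, by simp, by simp⟩
      | insert i s hi IH =>
        obtain ⟨Q, hQ, hPQ, hQs⟩ := IH
        refine ⟨taylorSum k (x i) (d i) Q (p + 1), ?_, ?_, ?_⟩
        · refine HasOrderLE.sum _ _ fun j hj => HasOrderLE.smul ?_ _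
          have hj' : j ≤ p + 1 := by have := Finset.mem_range.mp hj; omega
          have h1 := (hQ.adRight_iterate (MvPolynomial.X i) hj').mul
            ((HasOrderLE.derivation (MvPolynomial.pderiv (R := k) i)).pow j)
          rwa [mul_one, Nat.sub_add_cancel hj'] at h1
        -- The term `j = 0` is `Q` itself. The others have coefficients of order at most `p`, to
        -- which the induction on the order applies.
        · have h : P - taylorSum k (x i) (d i) Q (p + 1) = (P - Q) - ∑ j ∈ Finset.range (p + 1),
              ((-1) ^ (j + 1) / ((j + 1).factorial : k)) •
                ((adRight (x i))^[j + 1] Q * d i ^ (j + 1)) := by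
            rw [taylorSum, Finset.sum_range_succ']
            simp
            abel
          rw [h]
          refine sub_mem hPQ (sum_mem fun j hj => Subalgebra.smul_mem _ (mul_mem ?_ ?_) _)
          · have hj' : j + 1 ≤ p + 1 := by have := Finset.mem_range.mp hj; omega
            exact ih ((hQ.adRight_iterate (MvPolynomial.X i) hj').mono (by omega))
          · have hd : d i ∈ Algebra.adjoin k (weylGenerators n k) :=
              Algebra.subset_adjoin (Or.inr ⟨i, rfl⟩)
            exact pow_mem hd _
        · intro j hj
          rcases Finset.mem_insert.mp hj with rfl | hj
          · rw [adRight_taylorSum (hdx j), hQ.adRight_iterate_succ]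
            simp
          · have hne : j ≠ i := fun h => hi (h ▸ hj)
            exact adRight_taylorSum_eq_zero (hx i j) (hdx' i j hne) (hQs j hj) _
    obtain ⟨P', -, h1, h2⟩ := key Finset.univ
    have := add_mem h1 (mem_adjoin_of_commute_X fun i => h2 i (Finset.mem_univ i))
    rwa [sub_add_cancel] at this

variable {M : Type*} [AddCommGroup M] [Module (Poly n k) M]
  [Module (Diff n k) M] [IsScalarTower (Poly n k) (Diff n k) M]

/-- Used to show that the union of the filtration steps is a `𝒟`-submodule. -/
theorem Diff.smul_mem_of_del_smul_mem [CharZero k] {N : Submodule (Poly n k) M}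
    (hN : ∀ i : Fin n, ∀ m ∈ N, del k i • m ∈ N) (P : Diff n k) {m : M} (hm : m ∈ N) :
    P • m ∈ N := by
  obtain ⟨p, hp⟩ := P.2
  -- The generated algebra lies in `End(R)`, which does not act on `M`, so each operator is carried
  -- along with a lift to `𝒟`.
  have key : ∀ P ∈ Algebra.adjoin k (weylGenerators n k),
      ∃ Q : Diff n k, Q.1 = P ∧ ∀ m ∈ N, Q • m ∈ N := by
    intro P hP
    induction hP using Algebra.adjoin_induction with
    | mem x hx =>
      rcases hx with ⟨f, rfl⟩ | ⟨i, rfl⟩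
      · exact ⟨mulOp k (Poly n k) f, rfl, fun m hm => by rw [mulOp_smul]; exact N.smul_mem f hm⟩
      · exact ⟨del k i, rfl, hN i⟩
    | algebraMap c =>
      refine ⟨mulOp k (Poly n k) (algebraMap k _ c), ?_, fun m hm => by
        rw [mulOp_smul]; exact N.smul_mem _ hm⟩
      rw [AlgHom.commutes]
      rfl
    | add x y _ _ hx hy =>
      obtain ⟨Q, rfl, hQ⟩ := hx
      obtain ⟨Q', rfl, hQ'⟩ := hy
      exact ⟨Q + Q', rfl, fun m hm => by rw [add_smul]; exact N.add_mem (hQ m hm) (hQ' m hm)⟩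
    | mul x y _ _ hx hy =>
      obtain ⟨Q, rfl, hQ⟩ := hx
      obtain ⟨Q', rfl, hQ'⟩ := hy
      exact ⟨Q * Q', rfl, fun m hm => by rw [mul_smul]; exact hQ _ (hQ' m hm)⟩
  obtain ⟨Q, hQ, h⟩ := key P.1 hp.mem_adjoin
  rw [← Subtype.ext hQ]
  exact h m hm

end Weyl

/-! ### Maps that shift degrees, and finite generation of the filtration steps -/

section AdditiveMaps

variable {k A : Type*} [CommRing k] [CommRing A] [Algebra k A] {n : ℕ}
  {δ : Fin n → Derivation k A A}
  {N : Type*} [AddCommGroup N] [Module k N] [Module A N]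
  {B : Type*} [CommRing B] [Algebra k B] {ε : Fin n → Derivation k B B}
  {N' : Type*} [AddCommGroup N'] [Module k N'] [Module B N']

/-- Two maps occur because `∂ₛ` lowers degrees: in the applications `f` takes components of degree
`l + 1` and `g` those of degree `l`. -/
theorem Connection.d_comp_of_shift (D : Connection δ N) (E : Connection ε N') (f g : N →+ N')
    (hf : ∀ s m, g (D.op s m) = E.op s (f m)) (i : ℕ) (ω : Form n N i) :
    E.d i (fun S => f (ω S)) = fun T => g (D.d i ω T) := by
  funext T
  simp [Connection.d, hf]

/-- The steps of the filtration are finitely generated. -/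
theorem Connection.fil_fg (D : Connection δ N) {V : Submodule A N} (hV : V.FG) (q : ℕ) :
    (D.fil V q).FG := by
  classical
  induction q with
  | zero => exact hV
  | succ q ih =>
    obtain ⟨Y, hY⟩ := id ih
    -- By Leibniz `∂ₛ (a x) = a ∂ₛ x` modulo step `q`, so it is enough to differentiate generators
    -- of step `q`.
    have h : D.fil V (q + 1) = D.fil V q ⊔
        Submodule.span A ((Finset.univ ×ˢ Y).image fun z => D.op z.1 z.2 : Finset N) := by
      refine le_antisymm (sup_le le_sup_left (Submodule.span_le.mpr ?_))
        (sup_le le_sup_left (Submodule.span_le.mpr ?_))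
      · rintro _ ⟨s, m, hm, rfl⟩
        rw [SetLike.mem_coe]
        rw [← hY] at hm
        induction hm using Submodule.span_induction with
        | mem y hy =>
          refine Submodule.mem_sup_right (Submodule.subset_span ?_)
          exact Finset.mem_image_of_mem (fun z : Fin n × N => D.op z.1 z.2)
            (Finset.mem_product.mpr ⟨Finset.mem_univ (s, y).1, Finset.mem_coe.mp hy⟩)
        | zero => rw [map_zero]; exact Submodule.zero_mem _
        | add x y _ _ hx hy => rw [map_add]; exact Submodule.add_mem _ hx hy
        | smul a x hx' hx =>
          rw [D.leibniz]
          exact Submodule.add_mem _ (Submodule.smul_mem _ _ hx)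
            (Submodule.mem_sup_left (Submodule.smul_mem _ _ (hY ▸ hx')))
      · intro x hx
        obtain ⟨⟨s, y⟩, hz, rfl⟩ := Finset.mem_image.mp (Finset.mem_coe.mp hx)
        refine D.op_mem_fil V q s y ?_
        rw [← hY]
        exact Submodule.subset_span (Finset.mem_product.mp hz).2
    rw [h]
    exact ih.sup (Submodule.fg_span (Finset.finite_toSet _))

end AdditiveMaps

/-! ### Projections of an internal direct sum -/

section InternalProj

variable {k : Type*} [Field k] {M : Type*} [AddCommGroup M] [Module k M]
  {𝓜 : ℤ → Submodule k M} (h : DirectSum.IsInternal 𝓜)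

/-- The projection to the summand of degree `l`. -/
def internalProj (l : ℤ) : M →+ M :=
  let _ := h.chooseDecomposition
  AddMonoidHom.mk' (fun m => (DirectSum.decompose 𝓜 m l : M)) fun x y => by simp

theorem internalProj_mem (l : ℤ) (m : M) : internalProj h l m ∈ 𝓜 l :=
  let _ := h.chooseDecomposition
  (DirectSum.decompose 𝓜 m l).2

theorem internalProj_same {l : ℤ} {m : M} (hm : m ∈ 𝓜 l) : internalProj h l m = m :=
  let _ := h.chooseDecomposition
  DirectSum.decompose_of_mem_same 𝓜 hm

theorem internalProj_of_ne {l e : ℤ} {m : M} (hm : m ∈ 𝓜 e) (hel : e ≠ l) :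
    internalProj h l m = 0 :=
  let _ := h.chooseDecomposition
  DirectSum.decompose_of_mem_ne 𝓜 hm hel

theorem internalProj_internalProj (l l' : ℤ) (m : M) :
    internalProj h l (internalProj h l' m) = if l = l' then internalProj h l' m else 0 := by
  split_ifs with hl
  · subst hl
    exact internalProj_same h (internalProj_mem h l m)
  · exact internalProj_of_ne h (internalProj_mem h l' m) (Ne.symm hl)

theorem exists_sum_internalProj (m : M) : ∃ F : Finset ℤ, ∑ l ∈ F, internalProj h l m = m := by
  classical
  let _ := h.chooseDecomposition
  exact ⟨_, DirectSum.sum_support_decompose 𝓜 m⟩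

/-- Applied with `c = 0, 1, -1` to constants, variables and the `∂ᵢ`. -/
theorem internalProj_shift (T : M →+ M) (c : ℤ) (hT : ∀ l, ∀ m ∈ 𝓜 l, T m ∈ 𝓜 (l + c)) (l : ℤ)
    (m : M) : internalProj h l (T m) = T (internalProj h (l - c) m) := by
  have key : ∀ e, ∀ x ∈ 𝓜 e, internalProj h l (T x) = T (internalProj h (l - c) x) := by
    intro e x hx
    rcases eq_or_ne e (l - c) with rfl | he
    · rw [internalProj_same h hx]
      exact internalProj_same h (by simpa using hT _ x hx)
    · rw [internalProj_of_ne h hx he, internalProj_of_ne h (hT e x hx) (by omega), map_zero]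
  obtain ⟨F, hF⟩ := exists_sum_internalProj h m
  rw [← hF]
  simp only [map_sum]
  exact Finset.sum_congr rfl fun e _ => key e _ (internalProj_mem h e m)

end InternalProj

/-! ### Graded projections of forms over `M` -/

section GrProj

variable {n : ℕ} {k : Type*} [Field k] {M : Type*} [AddCommGroup M] [Module (Poly n k) M]

theorem GrProj.exists_sum_form (G : GrProj n k M) {i : ℕ} (ω : Form n M i) :
    ∃ F : Finset ℤ, ∀ S, ∑ l ∈ F, G.proj l (ω S) = ω S := by
  classical
  choose F hF using fun S => G.exists_sum (ω S)
  exact ⟨Finset.univ.biUnion F, fun S =>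
    G.sum_of_subset (hF S) (Finset.subset_biUnion_of_mem F (Finset.mem_univ S))⟩

variable [Module k M] [IsScalarTower k (Poly n k) M]

theorem GrProj.proj_smul_field (G : GrProj n k M) (l : ℤ) (c : k) (m : M) :
    G.proj l (c • m) = c • G.proj l m := by
  rw [← algebraMap_smul (Poly n k) c m, ← algebraMap_smul (Poly n k) c (G.proj l m)]
  exact G.proj_C l c m

theorem GrProj.tensorComp_kappa (G : GrProj n k M) (l : ℤ) (m : M) :
    G.tensorComp l (kappa n k M m) = G.proj l m := G.tensorComp_one_tmul l m

end GrProj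

/-! ### Comparison of the cohomology of `M` and of its completion -/

section GradedDModule

variable {n : ℕ} {k : Type*} [Field k]
variable {M : Type*} [AddCommGroup M] [Module k M] [Module (Poly n k) M]
  [IsScalarTower k (Poly n k) M]
  [Module (Diff n k) M] [IsScalarTower (Poly n k) (Diff n k) M]

/-- The projections of a graded `𝒟`-module. -/
def IsGrading.grProj {𝓜 : ℤ → Submodule k M} (h : IsGrading n k 𝓜) : GrProj n k M where
  proj := internalProj h.isInternal
  proj_C l a x := by
    have := internalProj_shift h.isInternal
      (DistribSMul.toAddMonoidHom M (MvPolynomial.C a : Poly n k)) 0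
      (fun e m hm => by
        simpa using h.smul_mem 0 e _ m (MvPolynomial.isHomogeneous_C (Fin n) a) hm) l x
    simpa using this
  proj_X l i x := internalProj_shift h.isInternal
    (DistribSMul.toAddMonoidHom M (MvPolynomial.X i : Poly n k)) 1
    (fun e m hm => by
      have := h.smul_mem 1 e _ m (MvPolynomial.isHomogeneous_X k i) hm
      rw [add_comm] at this
      simpa using this) l x
  proj_proj := internalProj_internalProj h.isInternal
  exists_sum := exists_sum_internalProj h.isInternal

/-- The operators `∂ᵢ` are homogeneous of degree `-1`. -/
def GrProj.Compatible (G : GrProj n k M) : Prop :=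
  ∀ l i m, G.proj l ((conn n k M).op i m) = (conn n k M).op i (G.proj (l + 1) m)

theorem IsGrading.compatible {𝓜 : ℤ → Submodule k M} (h : IsGrading n k 𝓜) :
    h.grProj.Compatible := fun l i m => by
  have := internalProj_shift h.isInternal (DistribSMul.toAddMonoidHom M (del k i)) (-1)
    (fun e m hm => h.del_smul_mem i e m hm) l m
  rwa [sub_neg_eq_add] at this

variable {G : GrProj n k M}

/-- For `s ⊗ m` with `m` homogeneous of degree `e`, both Leibniz terms involve the part of `s` of
degree `l + 1 - e`: one differentiates it, the other lowers the degree of `m`. -/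
theorem GrProj.Compatible.tensorComp_op (hG : G.Compatible) (l : ℤ) (i : Fin n)
    (x : Completion n k M) :
    G.tensorComp l ((completionConn n k M).op i x) =
      (conn n k M).op i (G.tensorComp (l + 1) x) := by
  change G.tensorComp l (completionOpAux n k M i x) = _
  induction x using TensorProduct.induction_on with
  | zero => simp
  | add x y hx hy => simp only [map_add, hx, hy]
  | tmul s m =>
    obtain ⟨F, hF⟩ := G.exists_sum m
    rw [← hF, TensorProduct.tmul_sum]
    simp only [map_sum]
    refine Finset.sum_congr rfl fun e _ => ?_
    have hm : G.proj e (G.proj e m) = G.proj e m := by rw [G.proj_proj, if_pos rfl]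
    generalize G.proj e m = m at hm
    have hop : G.proj (e - 1) ((conn n k M).op i m) = (conn n k M).op i m := by
      rw [hG, sub_add_cancel, hm]
    rw [completionOpAux_tmul, map_add, G.tensorComp_tmul_of_homogeneous _ _ hm,
      G.tensorComp_tmul_of_homogeneous _ _ hm, G.tensorComp_tmul_of_homogeneous _ _ hop,
      (conn n k M).leibniz, homPart_pderiv, add_comm, show l - e + 1 = l + 1 - e by ring,
      show l - (e - 1) = l + 1 - e by ring]

theorem GrProj.Compatible.d_proj (hG : G.Compatible) (l : ℤ) (i : ℕ) (ω : Form n M i) :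
    (conn n k M).d i (fun S => G.proj (l + 1) (ω S)) =
      fun T => G.proj l ((conn n k M).d i ω T) :=
  (conn n k M).d_comp_of_shift (conn n k M) _ _ (fun s m => hG l s m) i ω

theorem GrProj.Compatible.d_tensorComp (hG : G.Compatible) (l : ℤ) (i : ℕ)
    (ω : Form n (Completion n k M) i) :
    (conn n k M).d i (fun S => G.tensorComp (l + 1) (ω S)) =
      fun T => G.tensorComp l ((completionConn n k M).d i ω T) :=
  (completionConn n k M).d_comp_of_shift (conn n k M) _ _ (fun s m => hG.tensorComp_op l s m) i ω

/-- A primitive over the completion, cut down to the degrees `l + 1` with `l` occurring in `ω`, is a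
primitive over `M`. -/
theorem GrProj.Compatible.mem_coboundaries_of_kappa (hG : G.Compatible) {i : ℕ} {ω : Form n M i}
    (h : (kappa n k M).compLeft _ ω ∈ (completionConn n k M).coboundaries i) :
    ω ∈ (conn n k M).coboundaries i := by
  obtain ⟨F, hF⟩ := G.exists_sum_form ω
  cases i with
  | zero =>
    have h0 : (kappa n k M).compLeft _ ω = 0 := h
    change ω = 0
    funext S
    have hS : kappa n k M (ω S) = 0 := congrFun h0 S
    rw [← hF S]
    refine Finset.sum_eq_zero fun l _ => ?_
    rw [← G.tensorComp_kappa, hS, map_zero]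
  | succ i =>
    obtain ⟨η, hη⟩ := h
    refine ⟨∑ l ∈ F, fun S => G.tensorComp (l + 1) (η S), ?_⟩
    rw [map_sum]
    funext T
    rw [Finset.sum_apply, ← hF T]
    refine Finset.sum_congr rfl fun l _ => ?_
    rw [hG.d_tensorComp, hη]
    exact G.tensorComp_kappa l (ω T)

theorem GrProj.Compatible.kappaH_injective (hG : G.Compatible) (i : ℕ) :
    Function.Injective (kappaH n k M i) := by
  rw [injective_iff_map_eq_zero]
  intro x hx
  obtain ⟨ω, rfl⟩ := Submodule.Quotient.mk_surjective _ x
  rw [Submodule.Quotient.mk_eq_zero]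
  have h := (Submodule.Quotient.mk_eq_zero _).mp hx
  exact hG.mem_coboundaries_of_kappa h

theorem GrProj.Compatible.proj_mem_coboundaries (hG : G.Compatible) {i : ℕ} {ω : Form n M i}
    (h : ω ∈ (conn n k M).coboundaries i) (l : ℤ) :
    (fun S => G.proj l (ω S)) ∈ (conn n k M).coboundaries i := by
  cases i with
  | zero =>
    have h0 : ω = 0 := h
    subst h0
    change _ = 0
    funext S
    simp
  | succ i =>
    obtain ⟨η, rfl⟩ := h
    exact ⟨_, hG.d_proj l i η⟩

/-- If `Hⁱ_dR(M)` is finite-dimensional, it is concentrated in finitely many degrees. -/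
theorem GrProj.Compatible.finite_degrees (hG : G.Compatible) (i : ℕ)
    [FiniteDimensional k (HdR n k M i)] :
    {l : ℤ | ∃ ω ∈ (conn n k M).cocycles i, (∀ S, G.proj l (ω S) = ω S) ∧
      ω ∉ (conn n k M).coboundaries i}.Finite := by
  set Λ := {l : ℤ | ∃ ω ∈ (conn n k M).cocycles i, (∀ S, G.proj l (ω S) = ω S) ∧
      ω ∉ (conn n k M).coboundaries i}
  choose ω hω hproj hnot using fun l : Λ => l.2
  -- Classes in distinct degrees are independent: the degree `l` part of an exact combination is `c
  -- l • ω l`, which is then exact as well.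
  have hli : LinearIndependent k fun l : Λ =>
      (Submodule.Quotient.mk ⟨ω l, hω l⟩ : HdR n k M i) := by
    rw [linearIndependent_iff']
    intro s c hs l hl
    by_contra hc
    refine hnot l ?_
    have hs' : (∑ l ∈ s, c l • (⟨ω l, hω l⟩ : (conn n k M).cocycles i)) ∈
        ((conn n k M).coboundaries i).submoduleOf ((conn n k M).cocycles i) := by
      rw [← Submodule.Quotient.mk_eq_zero, ← hs, ← Submodule.mkQ_apply, map_sum]
      rfl
    have hs'' : (∑ l ∈ s, c l • ω l) ∈ (conn n k M).coboundaries i := by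
      have h := Submodule.mem_comap.mp hs'
      rwa [map_sum] at h
    have h := hG.proj_mem_coboundaries hs'' l
    have hl' : (fun S => G.proj l ((∑ l ∈ s, c l • ω l) S)) = c l • ω l := by
      funext S
      rw [Finset.sum_apply, map_sum, Finset.sum_eq_single_of_mem l hl]
      · rw [Pi.smul_apply, G.proj_smul_field, hproj]
      · intro l' _ hne
        rw [Pi.smul_apply, G.proj_smul_field, ← hproj l', G.proj_proj,
          if_neg (fun h => hne (Subtype.ext h.symm)), smul_zero]
    rw [hl'] at h
    have := Submodule.smul_mem _ (c l)⁻¹ h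
    rwa [smul_smul, inv_mul_cancel₀ hc, one_smul] at this
  have : Finite Λ := hli.finite_of_isNoetherian
  exact Set.toFinite Λ

/-- Lets primitives be replaced by homogeneous components within the same step, and makes
`exists_tensorComp_eq` applicable to that step. -/
theorem GrProj.Compatible.proj_mem_fil (hG : G.Compatible) {V : Submodule (Poly n k) M}
    (hV : ∀ x ∈ V, ∀ l, G.proj l x ∈ V) (q : ℕ) :
    ∀ x ∈ (conn n k M).fil V q, ∀ l, G.proj l x ∈ (conn n k M).fil V q := by
  induction q with
  | zero => exact hV
  | succ q ih =>
    intro x hx l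
    obtain ⟨y, hy, z, hz, rfl⟩ := Submodule.mem_sup.mp hx
    rw [map_add]
    refine Submodule.add_mem _ ((conn n k M).fil_le_succ V q (ih y hy l))
      (G.proj_mem_of_span ?_ hz l)
    rintro _ ⟨s, m, hm, rfl⟩ l
    rw [hG]
    exact (conn n k M).op_mem_fil V q s _ (ih m hm _)

/-- Take the homogeneous components of finitely many `𝒟`-generators. The union of the filtration
they define is stable under the `∂ᵢ`, hence under `𝒟`, hence is all of `M`. -/
theorem GrProj.exists_generators [CharZero k] [Module.Finite (Diff n k) M] (G : GrProj n k M) :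
    ∃ (t : ℕ) (g : Fin t → M),
      (∀ x ∈ Submodule.span (Poly n k) (Set.range g), ∀ l,
        G.proj l x ∈ Submodule.span (Poly n k) (Set.range g)) ∧
      ∀ m, ∃ q, m ∈ (conn n k M).fil (Submodule.span (Poly n k) (Set.range g)) q := by
  classical
  obtain ⟨A, hA⟩ := (Module.Finite.fg_top : (⊤ : Submodule (Diff n k) M).FG)
  choose F hF using G.exists_sum
  let Y : Finset M := A.biUnion fun x => (F x).image fun l => G.proj l x
  let e := Y.equivFin
  have hrange : Set.range (fun a => (e.symm a : M)) = Y := by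
    ext x
    constructor
    · rintro ⟨a, rfl⟩
      exact (e.symm a).2
    · intro hx
      exact ⟨e ⟨x, hx⟩, by simp⟩
  refine ⟨_, fun a => (e.symm a : M), ?_, ?_⟩
  · intro x hx
    refine G.proj_mem_of_span (fun y hy l => ?_) hx
    rw [hrange] at hy ⊢
    obtain ⟨z, hz, hy'⟩ := Finset.mem_biUnion.mp (Finset.mem_coe.mp hy)
    obtain ⟨l', -, rfl⟩ := Finset.mem_image.mp hy'
    rw [G.proj_proj]
    split_ifs
    · exact Submodule.subset_span hy
    · exact Submodule.zero_mem _
  · rw [hrange]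
    set V := Submodule.span (Poly n k) (Y : Set M)
    have hAV : ∀ x ∈ A, x ∈ V := by
      intro x hx
      rw [← hF x]
      refine Submodule.sum_mem _ fun l hl => Submodule.subset_span ?_
      exact Finset.mem_coe.mpr (Finset.mem_biUnion.mpr ⟨x, hx, Finset.mem_image_of_mem _ hl⟩)
    let U : ℕ →o Submodule (Poly n k) M := ⟨(conn n k M).fil V, (conn n k M).fil_mono V⟩
    have hdel : ∀ i : Fin n, ∀ m ∈ ⨆ q, U q, del k i • m ∈ ⨆ q, U q := by
      intro i m hm
      obtain ⟨q, hq⟩ := (Submodule.mem_iSup_of_chain U m).mp hm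
      exact (Submodule.mem_iSup_of_chain U _).mpr ⟨q + 1, (conn n k M).op_mem_fil V q i m hq⟩
    intro m
    refine (Submodule.mem_iSup_of_chain U m).mp ?_
    have hm : m ∈ Submodule.span (Diff n k) (A : Set M) := hA ▸ Submodule.mem_top
    induction hm using Submodule.span_induction with
    | mem x hx => exact (Submodule.mem_iSup_of_chain U x).mpr ⟨0, hAV x hx⟩
    | zero => exact Submodule.zero_mem _
    | add x y _ _ hx hy => exact Submodule.add_mem _ hx hy
    | smul P x _ hx => exact Diff.smul_mem_of_del_smul_mem hdel P hx

/-- A cocycle of the completion is the sum of a coboundary and of its components in the degrees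
where the cohomology of `M` does not vanish. -/
theorem GrProj.Compatible.exists_coboundary [CharZero k] [Module.Finite (Diff n k) M]
    (hG : G.Compatible) (i : ℕ) (Λ : Finset ℤ) (ω : Form n (Completion n k M) i)
    (hω : ∀ l ∉ Λ, (fun S => G.tensorComp l (ω S)) ∈ (conn n k M).coboundaries i) :
    ∃ ζ ∈ (completionConn n k M).coboundaries i,
      ∀ l S, G.tensorComp l (ζ S) = if l ∈ Λ then 0 else G.tensorComp l (ω S) := by
  cases i with
  | zero =>
    refine ⟨0, Submodule.zero_mem _, fun l S => ?_⟩
    split_ifs with hl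
    · simp
    · have h : (fun S => G.tensorComp l (ω S)) = 0 := hω l hl
      rw [congrFun h S]
      simp
  | succ i =>
    obtain ⟨t, g, hV, hex⟩ := G.exists_generators
    set V := Submodule.span (Poly n k) (Set.range g)
    have hfil := hG.proj_mem_fil hV
    -- An element is a finite sum of tensors `s ⊗ m`, whose components are `R`-combinations of
    -- components of `m`; one step therefore holds all degrees at once.
    have hbound : ∀ x : Completion n k M, ∃ p, ∀ l, G.tensorComp l x ∈ (conn n k M).fil V p := by
      intro x
      induction x using TensorProduct.induction_on with
      | zero => exact ⟨0, fun l => by simp⟩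
      | tmul s m =>
        obtain ⟨p, hp⟩ := hex m
        exact ⟨p, fun l => G.tensorComp_tmul_mem (hfil p m hp) l s⟩
      | add x y hx hy =>
        obtain ⟨p, hp⟩ := hx
        obtain ⟨p', hp'⟩ := hy
        exact ⟨max p p', fun l => by
          rw [map_add]
          exact Submodule.add_mem _ ((conn n k M).fil_mono V (le_max_left p p') (hp l))
            ((conn n k M).fil_mono V (le_max_right p p') (hp' l))⟩
    choose p hp using fun S => hbound (ω S)
    have hp' : ∀ l S, G.tensorComp l (ω S) ∈ (conn n k M).fil V (∑ S, p S) := fun l S =>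
      (conn n k M).fil_mono V
        (Finset.single_le_sum (f := p) (fun _ _ => Nat.zero_le _) (Finset.mem_univ S)) (hp S l)
    obtain ⟨q, hq⟩ := (conn n k M).exists_bounded_primitive g hex i (∑ S, p S)
    -- Since `d` lowers degrees, the component of degree `l` gets a primitive of degree `l + 1`; for
    -- `l ∈ Λ` the primitive is 0.
    have hη : ∀ l, ∃ η : Form n M i, (∀ S, η S ∈ (conn n k M).fil V q) ∧
        (∀ S, G.proj (l + 1) (η S) = η S) ∧
        ∀ T, (conn n k M).d i η T = if l ∈ Λ then 0 else G.tensorComp l (ω T) := by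
      intro l
      by_cases hl : l ∈ Λ
      · exact ⟨0, by simp, by simp, by simp [hl]⟩
      · obtain ⟨η, hη⟩ := hω l hl
        obtain ⟨η', h1, h2⟩ := hq η (by rw [hη]; exact hp' l)
        refine ⟨fun S => G.proj (l + 1) (η' S), fun S => hfil q _ (h1 S) _, fun S => ?_,
          fun T => ?_⟩
        · rw [G.proj_proj, if_pos rfl]
        · rw [hG.d_proj, h2, hη, if_neg hl]
          exact G.proj_tensorComp l (ω T)
    choose η h1 h2 h3 using hη
    have hVfg : V.FG := Submodule.fg_span (Set.finite_range g)
    -- The uniform `q` pays off: all primitives lie in one finitely generated step, so they are the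
    -- components of a form over the completion. The one of degree `l` is `η (l - 1)`.
    choose ξ hξ using fun S => G.exists_tensorComp_eq ((conn n k M).fil_fg hVfg q) (hfil q)
      (fun l => η (l - 1) S) (fun l => h1 _ S)
      (fun l => by simpa using h2 (l - 1) S)
    refine ⟨(completionConn n k M).d i ξ, ⟨ξ, rfl⟩, fun l T => ?_⟩
    have h := congrFun (hG.d_tensorComp l i ξ) T
    have hl : (fun S => G.tensorComp (l + 1) (ξ S)) = η l := by
      funext S
      rw [hξ, add_sub_cancel_right]
    rw [← h, ← h3 l T, hl]

theorem GrProj.Compatible.kappaH_surjective [CharZero k] [Module.Finite (Diff n k) M]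
    (hG : G.Compatible) (i : ℕ) [FiniteDimensional k (HdR n k M i)] :
    Function.Surjective (kappaH n k M i) := by
  intro x
  obtain ⟨⟨ω, hω⟩, rfl⟩ := Submodule.Quotient.mk_surjective _ x
  have hdω : (completionConn n k M).d i ω = 0 := hω
  let Λ := (hG.finite_degrees i).toFinset
  have hcocycle : ∀ l, (fun S => G.tensorComp l (ω S)) ∈ (conn n k M).cocycles i := by
    intro l
    have h := hG.d_tensorComp (l - 1) i ω
    rw [sub_add_cancel, hdω] at h
    change (conn n k M).d i _ = 0
    rw [h]
    funext T
    simp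
  obtain ⟨ζ, hζ, hζ'⟩ := hG.exists_coboundary i Λ ω fun l hl => by
    by_contra hnot
    exact hl ((hG.finite_degrees i).mem_toFinset.mpr
      ⟨_, hcocycle l, fun S => G.proj_tensorComp l (ω S), hnot⟩)
  -- The preimage: the sum of the finitely many components in degrees where cohomology may be
  -- nonzero. It differs from `ω` by `ζ`, as a comparison of components shows.
  let θ : (conn n k M).cocycles i := ∑ l ∈ Λ, ⟨_, hcocycle l⟩
  have hθ : ∀ S, θ.1 S = ∑ l ∈ Λ, G.tensorComp l (ω S) := fun S => by
    simp [θ]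
  refine ⟨Submodule.Quotient.mk θ, (Submodule.Quotient.eq _).mpr ?_⟩
  change (kappa n k M).compLeft _ θ.1 - ω ∈ (completionConn n k M).coboundaries i
  have heq : (kappa n k M).compLeft _ θ.1 - ω = -ζ := by
    rw [sub_eq_iff_eq_add, neg_add_eq_sub, eq_sub_iff_add_eq]
    funext S
    rw [← sub_eq_zero]
    refine G.tensorComp_injective fun l => ?_
    change G.tensorComp l (kappa n k M (θ.1 S) + ζ S - ω S) = 0
    rw [map_sub, map_add, G.tensorComp_kappa, hζ', hθ, map_sum]
    have hterm : ∀ l' ∈ Λ, G.proj l (G.tensorComp l' (ω S)) =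
        if l = l' then G.tensorComp l' (ω S) else 0 := fun l' _ => by
      rw [← G.proj_tensorComp l', G.proj_proj, G.proj_tensorComp]
    rw [Finset.sum_congr rfl hterm, Finset.sum_ite_eq]
    split_ifs <;> simp
  rw [heq]
  exact Submodule.neg_mem _ hζ

end GradedDModule

end DMod

end

theorem theoremA (n : ℕ) (k : Type*) [Field k] [CharZero k]
    (M : Type*) [AddCommGroup M] [Module k M] [Module (DMod.Poly n k) M]
    [IsScalarTower k (DMod.Poly n k) M]
    [Module (DMod.Diff n k) M] [IsScalarTower (DMod.Poly n k) (DMod.Diff n k) M]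
    [Module.Finite (DMod.Diff n k) M]
    (𝓜 : ℤ → Submodule k M) (h𝓜 : DMod.IsGrading n k 𝓜) (i : ℕ) :
    Function.Injective (DMod.kappaH n k M i) ∧
      (FiniteDimensional k (DMod.HdR n k M i) → Function.Bijective (DMod.kappaH n k M i)) := by
  have hG := h𝓜.compatible
  exact ⟨hG.kappaH_injective i,
    fun _ => ⟨hG.kappaH_injective i, hG.kappaH_surjective i⟩⟩
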